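/- For every $\delta>0$ and every real $B$ there is a constant $C(\delta,B)$ with the following property. Let $n\ge 1$ be an integer and let $d$ be a real number with $\delta\le d\le n-\delta$ (so that necessarily $n\ge 2\delta$). Let $W$ be a symmetric $n\times n$ real random matrix whose law has finite support of cardinality $N$, whose entries satisfy $|W_{ij}|\le B/\sqrt n$, and which is such that for every $w$ in the support and all $i<j$ the number $\frac dn+\sqrt{\frac dn\left(1-\frac dn\right)}\,w_{ij}$ lies in $[0,1]$. Let $G$ be the adjacency matrix of a random simple graph on $n$ vertices (symmetric, with zero diagonal) whose entries $G_{ij}$, $i<j$, are conditionally independent given $W$ with $$G_{ij}\sim\mathrm{Bernoulli}\left(\frac dn+\sqrt{\frac dn\left(1-\frac dn\right)}\,W_{ij}\right),$$ and let $Z=W+\xi$, where $\xi$ is independent of $W$ and is an $n\times n$ standard Gaussian Wigner matrix, that is, a symmetric matrix with independent entries on and above the diagonal, distributed as $\mathcal N(0,1)$ above the diagonal and as $\mathcal N(0,2)$ on the diagonal. Then the mutual informations $I(W;G)$ and $I(W;Z)$ (in nats) are finite and $$\left|I(W;G)-I(W;Z)\right|\le C(\delta,B)\left(\frac{n^{3/2}+n\sqrt{\log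 N}}{\sqrt{d(n-d)}}+\frac{n\log N}{d(n-d)}\right).$$ -/

import Mathlib

open MeasureTheory ProbabilityTheory

namespace ChannelUniversality

/-- Mutual information `I(X; Y)` (in nats) of two random variables on `(Ω, P)`: the relative entropy
between the joint law and the product of the marginal laws, with values in `[0, ∞]`. -/
noncomputable def mutualInfo {Ω E F : Type*} [MeasurableSpace Ω] [MeasurableSpace E]
    [MeasurableSpace F] (X : Ω → E) (Y : Ω → F) (P : Measure Ω) : ENNReal :=
  InformationTheory.klDiv (P.map (fun ω => (X ω, Y ω))) ((P.map X).prod (P.map Y))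

/-- `X` has the Bernoulli law with success probability `q` under `P`. This includes `0 ≤ q ≤ 1`;
the value `1` is taken with probability `q` and the value `0` with probability `1 - q`. -/
def HasBernoulliLaw {Ω : Type*} [MeasurableSpace Ω] (X : Ω → ℝ) (q : ℝ) (P : Measure Ω) : Prop :=
  ∃ p : unitInterval, (p : ℝ) = q ∧ HasLaw X (bernoulliMeasure (1 : ℝ) 0 p) P

/-- `ξ` is an `n × n` standard Gaussian Wigner matrix: symmetric, with independent entries on and
above the diagonal, `N(0, 1)` above the diagonal and `N(0, 2)` on the diagonal. -/
structure IsGaussianWigner {Ω : Type*} [MeasurableSpace Ω] {n : ℕ} (ξ : Ω → Fin n → Fin n → ℝ)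
    (P : Measure Ω) : Prop where
  measurable : Measurable ξ
  symm : ∀ᵐ ω ∂P, ∀ i j, ξ ω i j = ξ ω j i
  indep : iIndepFun (fun (e : {e : Fin n × Fin n // e.1 ≤ e.2}) (ω : Ω) => ξ ω e.1.1 e.1.2) P
  offDiag : ∀ i j, i < j → HasLaw (fun ω => ξ ω i j) (gaussianReal 0 1) P
  diag : ∀ i, HasLaw (fun ω => ξ ω i i) (gaussianReal 0 2) P

/-- The edge probability `d / n + √((d / n) (1 - d / n)) x` for an entry `x` of the signal. -/
noncomputable def edgeProb (n : ℕ) (d x : ℝ) : ℝ :=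
  d / n + √(d / n * (1 - d / n)) * x

/-- `G` is the adjacency matrix of a random simple graph on `n` vertices whose edges are, given the
discrete random matrix `W`, independent with
`G i j ∼ Bernoulli (d / n + √((d / n) (1 - d / n)) W i j)` for `i < j`. -/
structure IsBernoulliGraph {Ω : Type*} [MeasurableSpace Ω] {n : ℕ} (d : ℝ)
    (W G : Ω → Fin n → Fin n → ℝ) (P : Measure Ω) : Prop where
  measurable : Measurable G
  symm : ∀ᵐ ω ∂P, ∀ i j, G ω i j = G ω j i
  diag : ∀ᵐ ω ∂P, ∀ i, G ω i i = 0
  indep : ∀ w, P (W ⁻¹' {w}) ≠ 0 →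
    iIndepFun (fun (e : {e : Fin n × Fin n // e.1 < e.2}) (ω : Ω) => G ω e.1.1 e.1.2)
      (ProbabilityTheory.cond P (W ⁻¹' {w}))
  law : ∀ w, P (W ⁻¹' {w}) ≠ 0 → ∀ i j, i < j →
    HasBernoulliLaw (fun ω => G ω i j) (edgeProb n d (w i j))
      (ProbabilityTheory.cond P (W ⁻¹' {w}))

end ChannelUniversality

open MeasureTheory ProbabilityTheory

namespace ChannelUniversality

open InformationTheory
open scoped ENNReal NNReal unitInterval

/-! ### Relative entropy: invariance and disintegration -/

section Divergence

variable {X Y : Type*} [MeasurableSpace X] [MeasurableSpace Y]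

/-! The proof is a Lindeberg exchange carried out on mutual information itself. Given `W`, the
entries on and above the diagonal are independent outputs of scalar channels, Bernoulli or Gaussian,
so the channels can be exchanged one entry at a time. By the chain rule `channelInfo_prod`,
observing a second output adds the information it carries when the prior is replaced by the
posterior given the first. Hence a comparison of two scalar channels that is uniform in the prior
survives the presence of all other observations, and the errors add (`channelInfo_piKernel_le_add`).

For one entry with signal bounded by `ε` and `s² = q(1 - q)`, both informations equal half the prior
variance up to `O(ε³/s)`. For the Bernoulli channel this is a Taylor expansion of the divergence
(`abs_klBern_sub_le`). For the Gaussian channel it is the compensation identity, together with a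
chi-square bound of order `ε⁴` on the divergence of the output mixture from one Gaussian
(`klDiv_gaussianKernel_comp_le`). If `ε` is not small compared with `s`, both informations are
trivially `O(ε²) = O(ε³/s)`.

With `ε = B/√n` and `√(d(n - d)) = n s`, about `n²` off-diagonal errors sum to order `B³
n^{3/2}/√(d(n - d))`, and the diagonal costs at most `B²`. This already lies within the first term
of the bound; the logarithmic terms only enlarge it. -/

lemma klDiv_map_of_leftInverse (μ ν : Measure X) [IsFiniteMeasure μ] [IsFiniteMeasure ν]
    {f : X → Y} {g : Y → X} (hf : Measurable f) (hg : Measurable g)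
    (hgf : Function.LeftInverse g f) : klDiv (μ.map f) (ν.map f) = klDiv μ ν := by
  refine le_antisymm (klDiv_map_le μ ν hf) ?_
  have h := klDiv_map_le (μ.map f) (ν.map f) hg
  rwa [Measure.map_map hg hf, Measure.map_map hg hf, hgf.comp_eq_id, Measure.map_id,
    Measure.map_id] at h

/-- When almost all fibres are absolutely continuous, the joint density is the fibrewise density and
Tonelli applies. Otherwise the singular fibres have positive mass and both sides are infinite. -/
lemma klDiv_compProd_right_eq_lintegral [MeasurableSpace.CountableOrCountablyGenerated X Y]
    (μ : Measure X) [IsFiniteMeasure μ] (κ η : Kernel X Y) [IsMarkovKernel κ] [IsMarkovKernel η] :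
    klDiv (μ ⊗ₘ κ) (μ ⊗ₘ η) = ∫⁻ x, klDiv (κ x) (η x) ∂μ := by
  by_cases hac : ∀ᵐ x ∂μ, κ x ≪ η x
  · have hd : ∀ᵐ x ∂μ, κ x = (η.withDensity (κ.rnDeriv η)) x := by
      filter_upwards [hac] with x hx
      exact (Kernel.withDensity_rnDeriv_eq hx).symm
    have h2 : μ ⊗ₘ κ = (μ ⊗ₘ η).withDensity (fun p => κ.rnDeriv η p.1 p.2) := by
      rw [Measure.compProd_congr hd, Measure.compProd_withDensity (Kernel.measurable_rnDeriv κ η)]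
    rw [klDiv_eq_lintegral_klFun_of_ac (Measure.AbsolutelyContinuous.compProd_right hac)]
    have h3 : (μ ⊗ₘ κ).rnDeriv (μ ⊗ₘ η) =ᵐ[μ ⊗ₘ η] (fun p => κ.rnDeriv η p.1 p.2) := by
      rw [h2]
      exact Measure.rnDeriv_withDensity _ (Kernel.measurable_rnDeriv κ η)
    rw [lintegral_congr_ae (g := fun p => ENNReal.ofReal (klFun (κ.rnDeriv η p.1 p.2).toReal))
      (by filter_upwards [h3] with p hp; rw [hp])]
    rw [Measure.lintegral_compProd]
    · refine lintegral_congr_ae ?_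
      filter_upwards [hac] with x hx
      rw [klDiv_eq_lintegral_klFun_of_ac hx]
      refine lintegral_congr_ae ?_
      filter_upwards [Kernel.rnDeriv_eq_rnDeriv_measure (κ := κ) (η := η) (a := x)] with y hy
      rw [hy]
    · exact ENNReal.measurable_ofReal.comp (measurable_klFun.comp
        (Kernel.measurable_rnDeriv κ η).ennreal_toReal)
  · rw [klDiv_of_not_ac (fun h => hac (Measure.absolutelyContinuous_compProd_right_iff.mp h))]
    symm
    have hpos : μ {x | κ x ≪ η x}ᶜ ≠ 0 := hac
    rw [eq_top_iff]
    calc ∞ = ∫⁻ x in {x | κ x ≪ η x}ᶜ, ∞ ∂μ := by simp [hpos]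
      _ = ∫⁻ x in {x | κ x ≪ η x}ᶜ, klDiv (κ x) (η x) ∂μ := by
        refine setLIntegral_congr_fun (Kernel.measurableSet_absolutelyContinuous κ η).compl
          (fun x hx => ?_)
        exact (klDiv_of_not_ac hx).symm
      _ ≤ _ := setLIntegral_le_lintegral _ _

end Divergence

/-! ### Information of a channel, compensation identity and chain rule -/

section Channel

variable {S U V F : Type*} [MeasurableSpace S] [MeasurableSpace U] [MeasurableSpace V]
  [MeasurableSpace F]

/-- The mutual information between the input and the output of the channel `k` when the input has
law `ρ`. -/
noncomputable def channelInfo (ρ : Measure S) (k : Kernel S V) : ℝ≥0∞ :=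
  klDiv (ρ ⊗ₘ k) (ρ.prod (k ∘ₘ ρ))

lemma channelInfo_eq_lintegral [MeasurableSpace.CountableOrCountablyGenerated S V]
    (ρ : Measure S) [IsProbabilityMeasure ρ] (k : Kernel S V) [IsMarkovKernel k] :
    channelInfo ρ k = ∫⁻ x, klDiv (k x) (k ∘ₘ ρ) ∂ρ := by
  rw [channelInfo, ← Measure.compProd_const, klDiv_compProd_right_eq_lintegral]
  rfl

lemma channelInfo_map (ρ : Measure S) [IsProbabilityMeasure ρ] (k : Kernel S V) [IsMarkovKernel k]
    {f : V → F} {g : F → V} (hf : Measurable f) (hg : Measurable g)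
    (hgf : Function.LeftInverse g f) : channelInfo ρ (k.map f) = channelInfo ρ k := by
  have := Kernel.IsMarkovKernel.map k hf
  rw [channelInfo, channelInfo, Measure.compProd_map hf, ← Measure.map_comp _ _ hf,
    ← klDiv_map_of_leftInverse (ρ ⊗ₘ k) _ (f := Prod.map id f) (g := Prod.map id g) (by fun_prop)
      (by fun_prop) (fun p => Prod.ext rfl (hgf p.2))]
  congr 1
  rw [← Measure.map_prod_map _ _ measurable_id hf, Measure.map_id]

lemma channelInfo_const (ρ : Measure S) [IsProbabilityMeasure ρ] (μ : Measure V)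
    [IsProbabilityMeasure μ] : channelInfo ρ (Kernel.const S μ) = 0 := by
  rw [channelInfo, Measure.compProd_const, Measure.const_comp, measure_univ, one_smul, klDiv_self]

lemma channelInfo_prod_comm (ρ : Measure S) [IsProbabilityMeasure ρ]
    (h : Kernel S U) [IsMarkovKernel h] (k : Kernel S V) [IsMarkovKernel k] :
    channelInfo ρ (h ×ₖ k) = channelInfo ρ (k ×ₖ h) := by
  rw [← channelInfo_map ρ (h ×ₖ k) measurable_swap measurable_swap Prod.swap_swap,
    Kernel.map_prod_swap]

variable [StandardBorelSpace S] [Nonempty S]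

/-- Bayes' rule: swapping the factors of the joint law gives the output law followed by the
posterior, so information is also the divergence of posterior from prior. -/
lemma klDiv_posterior_const (ρ : Measure S) [IsProbabilityMeasure ρ] (k : Kernel S V)
    [IsMarkovKernel k] :
    klDiv ((k ∘ₘ ρ) ⊗ₘ k†ρ) ((k ∘ₘ ρ) ⊗ₘ Kernel.const V ρ) = channelInfo ρ k := by
  rw [compProd_posterior_eq_map_swap, Measure.compProd_const, ← Measure.prod_swap,
    klDiv_map_of_leftInverse _ _ measurable_swap measurable_swap Prod.swap_swap, channelInfo]

/-- The compensation identity. -/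
lemma lintegral_klDiv_eq_add [MeasurableSpace.CountableOrCountablyGenerated S V]
    (ρ : Measure S) [IsProbabilityMeasure ρ] (k : Kernel S V) [IsMarkovKernel k]
    (Q : Measure V) [IsProbabilityMeasure Q] :
    ∫⁻ x, klDiv (k x) Q ∂ρ = klDiv (k ∘ₘ ρ) Q + channelInfo ρ k := by
  -- Both sides are the divergence of the joint law from `ρ.prod Q`, disintegrated along the input
  -- on the left and along the output on the right.
  rw [← klDiv_posterior_const, ← klDiv_compProd_eq_add, compProd_posterior_eq_map_swap,
    Measure.compProd_const, ← Measure.prod_swap,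
    klDiv_map_of_leftInverse _ _ measurable_swap measurable_swap Prod.swap_swap,
    ← Measure.compProd_const, klDiv_compProd_right_eq_lintegral]
  rfl

lemma channelInfo_le_lintegral [MeasurableSpace.CountableOrCountablyGenerated S V]
    (ρ : Measure S) [IsProbabilityMeasure ρ] (k : Kernel S V) [IsMarkovKernel k]
    (Q : Measure V) [IsProbabilityMeasure Q] :
    channelInfo ρ k ≤ ∫⁻ x, klDiv (k x) Q ∂ρ := by
  rw [lintegral_klDiv_eq_add]
  exact le_add_self

/-- The chain rule for two conditionally independent observations of the same input. -/
lemma channelInfo_prod [MeasurableSpace.CountablyGenerated V]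
    (ρ : Measure S) [IsProbabilityMeasure ρ] (h : Kernel S U) [IsMarkovKernel h]
    (k : Kernel S V) [IsMarkovKernel k] :
    channelInfo ρ (h ×ₖ k) =
      ∫⁻ u, (klDiv ((h†ρ) u) ρ + channelInfo ((h†ρ) u) k) ∂(h ∘ₘ ρ) := by
  let f : S × (U × V) → U × (S × V) := fun p => (p.2.1, p.1, p.2.2)
  let g : U × (S × V) → S × (U × V) := fun p => (p.2.1, p.1, p.2.2)
  have hf : Measurable f := by fun_prop
  have hg : Measurable g := by fun_prop
  -- Put the first observation in front: given `u`, the input follows the posterior and the second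
  -- observation is still produced by `k`.
  have h1 : (ρ ⊗ₘ (h ×ₖ k)).map f = (h ∘ₘ ρ) ⊗ₘ (h†ρ ⊗ₖ k.prodMkLeft U) := by
    refine Measure.ext_of_lintegral _ fun φ hφ => ?_
    let ψ : U × S → ℝ≥0∞ := fun p => ∫⁻ v, φ (p.1, p.2, v) ∂(k p.2)
    have hψ : Measurable ψ := by
      have : Measurable fun q : (U × S) × V => φ (q.1.1, q.1.2, q.2) := by fun_prop
      exact this.lintegral_kernel_prod_right' (κ := k.prodMkLeft U)
    rw [lintegral_map hφ hf, Measure.lintegral_compProd (by fun_prop),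
      Measure.lintegral_compProd hφ]
    have hl : ∀ s, ∫⁻ p, φ (f (s, p)) ∂((h ×ₖ k) s) = ∫⁻ u, ψ (u, s) ∂(h s) := fun s =>
      Kernel.lintegral_prod _ _ _ (by fun_prop)
    have hr : ∀ u, ∫⁻ p, φ (u, p) ∂((h†ρ ⊗ₖ k.prodMkLeft U) u) = ∫⁻ s, ψ (u, s) ∂((h†ρ) u) :=
      fun u => Kernel.lintegral_compProd _ _ _ (by fun_prop)
    simp_rw [hl, hr]
    rw [← Measure.lintegral_compProd hψ, compProd_posterior_eq_map_swap,
      lintegral_map hψ measurable_swap, Measure.lintegral_compProd (by fun_prop)]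
    rfl
  have h2 : (ρ.prod ((h ×ₖ k) ∘ₘ ρ)).map f =
      (h ∘ₘ ρ) ⊗ₘ (Kernel.const U ρ ×ₖ (k ∘ₖ h†ρ)) := by
    have h3 : (h ×ₖ k) ∘ₘ ρ = (h ∘ₘ ρ) ⊗ₘ (k ∘ₖ h†ρ) := by
      rw [← Measure.snd_compProd, Measure.snd]
      have hm := congrArg (Measure.map (fun p : U × (S × V) => (p.1, p.2.2))) h1
      rw [Measure.map_map (by fun_prop) hf] at hm
      refine Eq.trans hm ?_
      refine Eq.trans (Measure.compProd_map (κ := h†ρ ⊗ₖ k.prodMkLeft U) measurable_snd).symm ?_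
      congr 1
      rw [← Kernel.snd_eq, Kernel.snd_compProd_prodMkLeft]
    refine Measure.ext_of_lintegral _ fun φ hφ => ?_
    rw [h3, lintegral_map hφ hf, lintegral_prod _ (by fun_prop), lintegral_lintegral_swap (by fun_prop),
      Measure.lintegral_compProd (by fun_prop), Measure.lintegral_compProd hφ]
    refine lintegral_congr fun u => ?_
    rw [Kernel.prod_apply, Kernel.const_apply, lintegral_prod _ (by fun_prop),
      lintegral_lintegral_swap (by fun_prop)]
  rw [channelInfo, ← klDiv_map_of_leftInverse _ _ hf hg (fun p => rfl), h1, h2,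
    klDiv_compProd_right_eq_lintegral]
  refine lintegral_congr fun u => ?_
  have h4 : (h†ρ ⊗ₖ k.prodMkLeft U) u = (h†ρ) u ⊗ₘ k := by
    rw [Kernel.compProd_apply_eq_compProd_sectR]
    congr 1
  -- For fixed `u` the reference is `ρ` times the output law of `k` under the posterior; the chain
  -- rule separates the change of prior from the information through `k`.
  rw [h4, Kernel.prod_apply, Kernel.const_apply, ← Measure.compProd_const, klDiv_compProd_eq_add,
    channelInfo, Measure.compProd_const, Kernel.comp_apply]

/-- In the chain rule the posterior and its divergence from `ρ` depend on `h` alone. The remaining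
term is information under the posterior, which is why `hk` must hold for every prior. -/
lemma channelInfo_prod_le_add [MeasurableSpace.CountablyGenerated V]
    {V' : Type*} [MeasurableSpace V'] [MeasurableSpace.CountablyGenerated V']
    (h : Kernel S U) [IsMarkovKernel h] (k : Kernel S V) [IsMarkovKernel k]
    (k' : Kernel S V') [IsMarkovKernel k'] {c : ℝ≥0∞}
    (hk : ∀ (ρ : Measure S) [IsProbabilityMeasure ρ], channelInfo ρ k ≤ channelInfo ρ k' + c)
    (ρ : Measure S) [IsProbabilityMeasure ρ] :
    channelInfo ρ (h ×ₖ k) ≤ channelInfo ρ (h ×ₖ k') + c := by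
  rw [channelInfo_prod, channelInfo_prod]
  calc ∫⁻ u, (klDiv ((h†ρ) u) ρ + channelInfo ((h†ρ) u) k) ∂(h ∘ₘ ρ)
      ≤ ∫⁻ u, (klDiv ((h†ρ) u) ρ + channelInfo ((h†ρ) u) k') + c ∂(h ∘ₘ ρ) := by
        refine lintegral_mono fun u => ?_
        rw [add_assoc]
        exact add_le_add_right (hk _) _
    _ = _ := by rw [lintegral_add_right _ measurable_const]; simp

end Channel
-- Product channels and the entrywise exchange
section Product

variable {S V : Type*} [MeasurableSpace S] [DiscreteMeasurableSpace S] [MeasurableSpace V]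

/-- The channel whose outputs are conditionally independent given the input, the `i`-th one being
the output of `k i`. -/
noncomputable def piKernel {ι : Type*} [Fintype ι] (k : ι → Kernel S V) : Kernel S (ι → V) where
  toFun s := Measure.pi fun i => k i s
  measurable' := Measurable.of_discrete

variable {ι : Type*} [Fintype ι]

lemma piKernel_apply (k : ι → Kernel S V) (s : S) : piKernel k s = Measure.pi fun i => k i s := rfl

instance (k : ι → Kernel S V) [∀ i, IsMarkovKernel (k i)] : IsMarkovKernel (piKernel k) :=
  ⟨fun s => by rw [piKernel_apply]; infer_instance⟩

lemma map_piKernel_finSucc {m : ℕ} (k : Fin (m + 1) → Kernel S V) [∀ i, IsMarkovKernel (k i)] :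
    (piKernel k).map (MeasurableEquiv.piFinSuccAbove (fun _ => V) 0) =
      k 0 ×ₖ piKernel (fun i => k (Fin.succAbove 0 i)) := by
  ext1 s
  rw [Kernel.map_apply _ (MeasurableEquiv.measurable _), Kernel.prod_apply, piKernel_apply,
    piKernel_apply]
  exact (measurePreserving_piFinSuccAbove (fun i => k i s) 0).map_eq

lemma channelInfo_piKernel_finSucc {m : ℕ} (ρ : Measure S) [IsProbabilityMeasure ρ]
    (k : Fin (m + 1) → Kernel S V) [∀ i, IsMarkovKernel (k i)] :
    channelInfo ρ (piKernel k) =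
      channelInfo ρ (k 0 ×ₖ piKernel (fun i => k (Fin.succAbove 0 i))) := by
  rw [← map_piKernel_finSucc, channelInfo_map _ _ (MeasurableEquiv.measurable _)
    (MeasurableEquiv.measurable _) (MeasurableEquiv.symm_apply_apply _)]

lemma channelInfo_piKernel_reindex {κ : Type*} [Fintype κ] (e : κ ≃ ι)
    (ρ : Measure S) [IsProbabilityMeasure ρ]
    (k : ι → Kernel S V) [∀ i, IsMarkovKernel (k i)] :
    channelInfo ρ (piKernel k) = channelInfo ρ (piKernel fun i => k (e i)) := by
  have : (piKernel fun i => k (e i)).map (MeasurableEquiv.piCongrLeft (fun _ => V) e) =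
      piKernel k := by
    ext1 s
    rw [Kernel.map_apply _ (MeasurableEquiv.measurable _), piKernel_apply, piKernel_apply]
    exact (measurePreserving_piCongrLeft (fun i => k i s) e).map_eq
  rw [← this, channelInfo_map _ _ (MeasurableEquiv.measurable _)
    (MeasurableEquiv.measurable _) (MeasurableEquiv.symm_apply_apply _)]

variable [StandardBorelSpace S] [Nonempty S] [StandardBorelSpace V]

lemma channelInfo_piKernel_fin_le_add {m : ℕ} (k k' : Fin m → Kernel S V)
    [∀ i, IsMarkovKernel (k i)] [∀ i, IsMarkovKernel (k' i)] (c : Fin m → ℝ≥0∞)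
    (hk : ∀ i, ∀ (ρ : Measure S) [IsProbabilityMeasure ρ],
      channelInfo ρ (k i) ≤ channelInfo ρ (k' i) + c i)
    (ρ : Measure S) [IsProbabilityMeasure ρ] :
    channelInfo ρ (piKernel k) ≤ channelInfo ρ (piKernel k') + ∑ i, c i := by
  induction m generalizing ρ with
  | zero =>
    rw [show k = k' from funext fun i => i.elim0]
    exact le_self_add
  | succ m ih =>
    rw [channelInfo_piKernel_finSucc, channelInfo_piKernel_finSucc, Fin.sum_univ_succAbove _ 0]
    calc channelInfo ρ (k 0 ×ₖ piKernel (fun i => k (Fin.succAbove 0 i)))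
        ≤ channelInfo ρ (k 0 ×ₖ piKernel (fun i => k' (Fin.succAbove 0 i)))
            + ∑ i, c (Fin.succAbove 0 i) :=
          channelInfo_prod_le_add _ _ _ (fun ρ _ => ih _ _ _ (fun i => hk _) ρ) ρ
      -- The exchange acts on the second factor, so the factors are swapped to reach the head
      -- coordinate.
      _ = channelInfo ρ (piKernel (fun i => k' (Fin.succAbove 0 i)) ×ₖ k 0)
            + ∑ i, c (Fin.succAbove 0 i) := by rw [channelInfo_prod_comm]
      _ ≤ channelInfo ρ (piKernel (fun i => k' (Fin.succAbove 0 i)) ×ₖ k' 0) + c 0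
            + ∑ i, c (Fin.succAbove 0 i) := by
          gcongr
          exact channelInfo_prod_le_add _ _ _ (hk 0) ρ
      _ = _ := by rw [channelInfo_prod_comm, add_assoc]

/-- Outputs of a product channel may be exchanged one at a time: a comparison of the two
single-output channels that is uniform in the prior adds up. -/
lemma channelInfo_piKernel_le_add (k k' : ι → Kernel S V)
    [∀ i, IsMarkovKernel (k i)] [∀ i, IsMarkovKernel (k' i)] (c : ι → ℝ≥0∞)
    (hk : ∀ i, ∀ (ρ : Measure S) [IsProbabilityMeasure ρ],
      channelInfo ρ (k i) ≤ channelInfo ρ (k' i) + c i)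
    (ρ : Measure S) [IsProbabilityMeasure ρ] :
    channelInfo ρ (piKernel k) ≤ channelInfo ρ (piKernel k') + ∑ i, c i := by
  let e := (Fintype.equivFin ι).symm
  rw [channelInfo_piKernel_reindex e, channelInfo_piKernel_reindex e ρ k', ← e.sum_comp]
  exact channelInfo_piKernel_fin_le_add _ _ _ (fun i => hk _) ρ

/-- Exchange every output for a constant one, which carries no information. -/
lemma channelInfo_piKernel_le_sum [Inhabited V] (k : ι → Kernel S V) [∀ i, IsMarkovKernel (k i)]
    (c : ι → ℝ≥0∞)
    (hk : ∀ i, ∀ (ρ : Measure S) [IsProbabilityMeasure ρ], channelInfo ρ (k i) ≤ c i)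
    (ρ : Measure S) [IsProbabilityMeasure ρ] :
    channelInfo ρ (piKernel k) ≤ ∑ i, c i := by
  have h := channelInfo_piKernel_le_add k (fun _ => Kernel.const S (Measure.dirac default)) c
    (fun i ρ _ => (hk i ρ).trans le_add_self) ρ
  have h0 : piKernel (fun _ : ι => Kernel.const S (Measure.dirac (default : V)))
      = Kernel.const S (Measure.pi fun _ => Measure.dirac default) := by
    ext1 s; rw [piKernel_apply, Kernel.const_apply]; rfl
  rwa [h0, channelInfo_const, zero_add] at h

end Product
-- Expansion of the Bernoulli divergence
section RealEstimates

/-- From `log t ≤ t - 1`; integrated, it bounds relative entropy by the chi-square divergence. -/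
lemma klFun_le_sq {t : ℝ} (ht : 0 ≤ t) : klFun t ≤ (t - 1) ^ 2 := by
  rw [klFun_apply]
  rcases ht.eq_or_lt with rfl | h
  · norm_num
  · nlinarith [mul_le_mul_of_nonneg_left (Real.log_le_sub_one_of_pos h) ht]

lemma abs_klFun_one_add_sub_le {t : ℝ} (ht : |t| ≤ 1 / 2) :
    |klFun (1 + t) - t ^ 2 / 2| ≤ 4 * |t| ^ 3 := by
  have h := Real.abs_log_sub_add_sum_range_le (x := -t) (by rw [abs_neg]; linarith) 2
  simp only [Finset.sum_range_succ, Finset.sum_range_zero, abs_neg, sub_neg_eq_add] at h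
  set R := Real.log (1 + t) - t + t ^ 2 / 2 with hR
  have hR' : |R| ≤ 2 * |t| ^ 3 := by
    have h1 : |t| ^ 3 / (1 - |t|) ≤ 2 * |t| ^ 3 := by
      rw [div_le_iff₀ (by linarith)]
      nlinarith [pow_nonneg (abs_nonneg t) 3]
    refine le_trans (le_of_eq ?_) (h.trans h1)
    congr 1
    rw [hR]; push_cast; ring
  have he : klFun (1 + t) - t ^ 2 / 2 = (1 + t) * R - t ^ 3 / 2 := by
    rw [klFun_apply, hR]; ring
  rw [he]
  have h3 : |1 + t| ≤ 3 / 2 := by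
    rw [abs_le] at ht ⊢; constructor <;> linarith
  calc |(1 + t) * R - t ^ 3 / 2| ≤ |(1 + t) * R| + |t ^ 3 / 2| := abs_sub _ _
    _ = |1 + t| * |R| + |t| ^ 3 / 2 := by rw [abs_mul, abs_div, abs_pow]; norm_num
    _ ≤ 3 / 2 * (2 * |t| ^ 3) + |t| ^ 3 / 2 := by gcongr
    _ ≤ _ := by nlinarith [pow_nonneg (abs_nonneg t) 3]

/-- The relative entropy between the Bernoulli laws with parameters `p` and `r`. -/
noncomputable def klBern (p r : ℝ) : ℝ := r * klFun (p / r) + (1 - r) * klFun ((1 - p) / (1 - r))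

lemma klBern_le {p r : ℝ} (hp : p ∈ Set.Icc (0 : ℝ) 1) (hr : r ∈ Set.Ioo (0 : ℝ) 1) :
    klBern p r ≤ (p - r) ^ 2 / (r * (1 - r)) := by
  obtain ⟨hr0, hr1⟩ := hr
  have hr1' : 0 < 1 - r := by linarith
  have h1 := klFun_le_sq (div_nonneg hp.1 hr0.le)
  have h2 := klFun_le_sq (div_nonneg (sub_nonneg.2 hp.2) hr1'.le)
  calc klBern p r ≤ r * (p / r - 1) ^ 2 + (1 - r) * ((1 - p) / (1 - r) - 1) ^ 2 := by
        unfold klBern; gcongr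
    _ = _ := by field_simp; ring

/-- Expand both `klFun` terms to second order in `u = s(x - y)`. The quadratic parts sum to
`u²/(2r(1 - r))`, where `r(1 - r)` may be replaced by `s²` at cost `4ε³/s`; the Taylor remainders
cost `128ε³/s`. The bound `ε ≤ s/8` keeps `r` and `1 - r` comparable to `q` and `1 - q`, and the
relative increments below `1/2`. -/
lemma abs_klBern_sub_le {q s x y ε : ℝ} (hq : q ∈ Set.Ioo (0 : ℝ) 1) (hs0 : 0 < s)
    (hs : s ^ 2 = q * (1 - q)) (hx : |x| ≤ ε) (hy : |y| ≤ ε) (hε : ε ≤ s / 8) :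
    |klBern (q + s * x) (q + s * y) - (x - y) ^ 2 / 2| ≤ 200 * (ε ^ 3 / s) := by
  obtain ⟨hq0, hq1⟩ := hq
  have hε0 : 0 ≤ ε := (abs_nonneg x).trans hx
  set r := q + s * y with hr
  set u := s * (x - y) with hu
  have hp : q + s * x = r + u := by rw [hr, hu]; ring
  have hxy : |x - y| ≤ 2 * ε := (abs_sub x y).trans (by linarith)
  have hua : |u| ≤ 2 * ε * s := by
    rw [hu, abs_mul, abs_of_pos hs0]; nlinarith
  have hsy : |s * y| ≤ s * ε := by rw [abs_mul, abs_of_pos hs0]; gcongr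
  have hsε : s * ε ≤ q * (1 - q) / 8 := by rw [← hs]; nlinarith
  have hsy' := abs_le.1 (hsy.trans hsε)
  have hqq : q * (1 - q) ≤ q := by nlinarith
  have hqq' : q * (1 - q) ≤ 1 - q := by nlinarith
  have hr0 : 7 / 8 * q ≤ r := by linarith
  have hr1 : 7 / 8 * (1 - q) ≤ 1 - r := by linarith
  have hrpos : 0 < r := by linarith
  have hrpos' : 0 < 1 - r := by linarith
  have hrr : s ^ 2 / 2 ≤ r * (1 - r) := by
    rw [hs]
    calc q * (1 - q) / 2 ≤ (7 / 8 * q) * (7 / 8 * (1 - q)) := by nlinarith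
      _ ≤ _ := by gcongr
  have hu2 : |u| ≤ q * (1 - q) / 4 := by linarith
  have ht1 : |u / r| ≤ 1 / 2 := by
    rw [abs_div, abs_of_pos hrpos, div_le_iff₀ hrpos]; linarith
  have ht2 : |-u / (1 - r)| ≤ 1 / 2 := by
    rw [abs_div, abs_neg, abs_of_pos hrpos', div_le_iff₀ hrpos']; linarith
  have h1 := abs_klFun_one_add_sub_le ht1
  have h2 := abs_klFun_one_add_sub_le ht2
  have e1 : (r + u) / r = 1 + u / r := by field_simp
  have e2 : (1 - (r + u)) / (1 - r) = 1 + -u / (1 - r) := by field_simp; ring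
  have hquad : |u ^ 2 / (2 * (r * (1 - r))) - (x - y) ^ 2 / 2| ≤ 4 * (ε ^ 3 / s) := by
    -- This uses `q(1 - q) - r(1 - r) = (r - q)(q + r - 1)` with `r - q = s y`.
    have h3 : u ^ 2 / (2 * (r * (1 - r))) - (x - y) ^ 2 / 2
        = (x - y) ^ 2 * ((s * y) * (q + r - 1)) / (2 * (r * (1 - r))) := by
      have hrr0 : r * (1 - r) ≠ 0 := by positivity
      have : u ^ 2 = (x - y) ^ 2 * s ^ 2 := by rw [hu]; ring
      rw [this, hs]
      field_simp
      rw [hr]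
      ring
    have h4 : |q + r - 1| ≤ 1 := by rw [abs_le]; constructor <;> linarith
    rw [h3, abs_div, abs_mul, abs_mul, abs_of_nonneg (sq_nonneg (x - y)),
      abs_of_pos (show 0 < 2 * (r * (1 - r)) by positivity), ← sq_abs (x - y)]
    calc |x - y| ^ 2 * (|s * y| * |q + r - 1|) / (2 * (r * (1 - r)))
        ≤ (2 * ε) ^ 2 * (s * ε * 1) / (2 * (s ^ 2 / 2)) := by gcongr
      _ = _ := by field_simp; ring
  have hcub : r * (4 * |u / r| ^ 3) + (1 - r) * (4 * |-u / (1 - r)| ^ 3) ≤ 128 * (ε ^ 3 / s) := by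
    rw [abs_div, abs_div, abs_neg, abs_of_pos hrpos, abs_of_pos hrpos']
    calc r * (4 * (|u| / r) ^ 3) + (1 - r) * (4 * (|u| / (1 - r)) ^ 3)
        = 4 * |u| ^ 3 * (r ^ 2 + (1 - r) ^ 2) / (r * (1 - r)) ^ 2 := by field_simp; ring
      _ ≤ 4 * (2 * ε * s) ^ 3 * 1 / (s ^ 2 / 2) ^ 2 := by
          gcongr
          nlinarith
      _ = _ := by field_simp; ring
  have key : klBern (q + s * x) r - (x - y) ^ 2 / 2
      = r * (klFun (1 + u / r) - (u / r) ^ 2 / 2)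
        + (1 - r) * (klFun (1 + -u / (1 - r)) - (-u / (1 - r)) ^ 2 / 2)
        + (u ^ 2 / (2 * (r * (1 - r))) - (x - y) ^ 2 / 2) := by
    rw [klBern, hp, e1, e2]
    field_simp
    ring
  rw [key]
  refine (abs_add_three _ _ _).trans ?_
  rw [abs_mul, abs_mul, abs_of_pos hrpos, abs_of_pos hrpos']
  have a1 := mul_le_mul_of_nonneg_left h1 hrpos.le
  have a2 := mul_le_mul_of_nonneg_left h2 hrpos'.le
  have : 0 ≤ ε ^ 3 / s := by positivity
  linarith

end RealEstimates
-- Divergences of Bernoulli and Gaussian laws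
section Laws

lemma klDiv_withDensity_ofReal {X : Type*} [MeasurableSpace X] (ν : Measure X) [IsFiniteMeasure ν]
    {f : X → ℝ} (hf : Measurable f) (hf0 : ∀ x, 0 ≤ f x)
    [IsFiniteMeasure (ν.withDensity fun x => ENNReal.ofReal (f x))] :
    klDiv (ν.withDensity fun x => ENNReal.ofReal (f x)) ν
      = ∫⁻ x, ENNReal.ofReal (klFun (f x)) ∂ν := by
  rw [klDiv_eq_lintegral_klFun_of_ac (withDensity_absolutelyContinuous _ _)]
  refine lintegral_congr_ae ?_
  filter_upwards [Measure.rnDeriv_withDensity ν hf.ennreal_ofReal] with x hx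
  rw [hx, ENNReal.toReal_ofReal (hf0 x)]

lemma lintegral_bernoulliMeasure {X : Type*} [MeasurableSpace X] [MeasurableSingletonClass X]
    (x y : X) (p : I) (f : X → ℝ≥0∞) :
    ∫⁻ z, f z ∂(bernoulliMeasure x y p)
      = ENNReal.ofReal p * f x + ENNReal.ofReal (1 - p) * f y := by
  rw [bernoulliMeasure_def, lintegral_add_measure]
  have h1 : ((unitInterval.toNNReal p : ℝ≥0) : ℝ≥0∞) = ENNReal.ofReal p := by
    rw [ENNReal.ofReal]; congr 1; ext; simp [p.2.1]
  have h2 : ((unitInterval.toNNReal (unitInterval.symm p) : ℝ≥0) : ℝ≥0∞)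
      = ENNReal.ofReal (1 - p) := by
    rw [ENNReal.ofReal]; congr 1; ext; simp [p.2.2]
  simp [ENNReal.smul_def, h1, h2]

lemma klDiv_bernoulliMeasure (p r : I) (hr : (r : ℝ) ∈ Set.Ioo (0 : ℝ) 1) :
    klDiv (bernoulliMeasure (1 : ℝ) 0 p) (bernoulliMeasure 1 0 r)
      = ENNReal.ofReal (klBern p r) := by
  have hr' : 0 < 1 - (r : ℝ) := sub_pos.2 hr.2
  have hp' : 0 ≤ 1 - (p : ℝ) := sub_nonneg.2 p.2.2
  let f : ℝ → ℝ := fun z => if z = 1 then (p : ℝ) / r else (1 - p) / (1 - r)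
  have hf : Measurable f := Measurable.ite (measurableSet_singleton 1) (by fun_prop) (by fun_prop)
  have hf0 : ∀ z, 0 ≤ f z := fun z => by
    simp only [f]; split_ifs
    · exact div_nonneg p.2.1 hr.1.le
    · exact div_nonneg hp' hr'.le
  have h : bernoulliMeasure (1 : ℝ) 0 p
      = (bernoulliMeasure (1 : ℝ) 0 r).withDensity fun z => ENNReal.ofReal (f z) := by
    refine Measure.ext_of_lintegral _ fun φ hφ => ?_
    rw [lintegral_withDensity_eq_lintegral_mul _ hf.ennreal_ofReal hφ,
      lintegral_bernoulliMeasure, lintegral_bernoulliMeasure]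
    simp only [Pi.mul_apply, f, if_true, zero_ne_one, if_false, ← mul_assoc]
    rw [← ENNReal.ofReal_mul hr.1.le, ← ENNReal.ofReal_mul hr'.le, mul_div_cancel₀ _ hr.1.ne',
      mul_div_cancel₀ _ hr'.ne']
  have : IsFiniteMeasure ((bernoulliMeasure (1 : ℝ) 0 r).withDensity
      fun z => ENNReal.ofReal (f z)) := by rw [← h]; infer_instance
  rw [h, klDiv_withDensity_ofReal _ hf hf0, lintegral_bernoulliMeasure]
  simp only [f, if_true, zero_ne_one, if_false]
  rw [← ENNReal.ofReal_mul hr.1.le, ← ENNReal.ofReal_mul hr'.le, ← ENNReal.ofReal_add, klBern]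
  · exact mul_nonneg hr.1.le (klFun_nonneg (div_nonneg p.2.1 hr.1.le))
  · exact mul_nonneg hr'.le (klFun_nonneg (div_nonneg hp' hr'.le))

lemma gaussianReal_eq_withDensity (a b : ℝ) {v : ℝ≥0} (hv : v ≠ 0) :
    gaussianReal a v = (gaussianReal b v).withDensity
      fun y => ENNReal.ofReal (Real.exp ((a - b) * (y - b) / v - (a - b) ^ 2 / (2 * v))) := by
  rw [gaussianReal_of_var_ne_zero _ hv, gaussianReal_of_var_ne_zero _ hv,
    ← withDensity_mul _ (measurable_gaussianPDF _ _) (by fun_prop)]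
  congr 1
  ext y
  have hv' : (v : ℝ) ≠ 0 := by exact_mod_cast hv
  rw [Pi.mul_apply, gaussianPDF, gaussianPDF, ← ENNReal.ofReal_mul (gaussianPDFReal_nonneg _ _ _),
    gaussianPDFReal, gaussianPDFReal, mul_assoc (√(2 * Real.pi * v))⁻¹, ← Real.exp_add]
  congr 3
  field_simp
  ring

lemma klDiv_gaussianReal (a b : ℝ) {v : ℝ≥0} (hv : v ≠ 0) :
    klDiv (gaussianReal a v) (gaussianReal b v) = ENNReal.ofReal ((a - b) ^ 2 / (2 * v)) := by
  have hv' : (v : ℝ) ≠ 0 := by exact_mod_cast hv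
  have hac : gaussianReal a v ≪ gaussianReal b v := by
    rw [gaussianReal_eq_withDensity a b hv]; exact withDensity_absolutelyContinuous _ _
  have hllr : llr (gaussianReal a v) (gaussianReal b v) =ᵐ[gaussianReal a v]
      fun y => (a - b) / v * y + (-(a - b) * b / v - (a - b) ^ 2 / (2 * v)) := by
    refine hac.ae_eq ?_
    have h := Measure.rnDeriv_withDensity (gaussianReal b v)
      (f := fun y => ENNReal.ofReal (Real.exp ((a - b) * (y - b) / v - (a - b) ^ 2 / (2 * v))))
      (by fun_prop)
    rw [← gaussianReal_eq_withDensity a b hv] at h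
    filter_upwards [h] with y hy
    rw [llr, hy, ENNReal.toReal_ofReal (Real.exp_nonneg _), Real.log_exp]
    ring
  have hid : Integrable (fun y : ℝ => y) (gaussianReal a v) :=
    (memLp_id_gaussianReal 1).integrable le_rfl
  have hint : Integrable (fun y => (a - b) / v * y + (-(a - b) * b / v - (a - b) ^ 2 / (2 * v)))
      (gaussianReal a v) := (hid.const_mul _).add (integrable_const _)
  rw [klDiv_of_ac_of_integrable hac ((integrable_congr hllr).2 hint), integral_congr_ae hllr,
    integral_add (hid.const_mul _) (integrable_const _), integral_const_mul,
    integral_id_gaussianReal]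
  simp only [integral_const, probReal_univ, smul_eq_mul, one_mul]
  congr 1
  field_simp
  ring

lemma integrable_exp_gaussianReal (b t c : ℝ) :
    Integrable (fun y => Real.exp (t * (y - b) - c)) (gaussianReal b 1) := by
  have : (fun y => Real.exp (t * (y - b) - c))
      = fun y => Real.exp (- t * b - c) * Real.exp (t * y) := by
    ext y; rw [← Real.exp_add]; ring_nf
  rw [this]
  exact (integrable_exp_mul_gaussianReal t).const_mul _

lemma integral_exp_gaussianReal (b t c : ℝ) :
    ∫ y, Real.exp (t * (y - b) - c) ∂(gaussianReal b 1) = Real.exp (t ^ 2 / 2 - c) := by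
  have : (fun y => Real.exp (t * (y - b) - c))
      = fun y => Real.exp (- t * b - c) * Real.exp (t * y) := by
    ext y; rw [← Real.exp_add]; ring_nf
  have h := congrFun (mgf_fun_id_gaussianReal (μ := b) (v := 1)) t
  rw [mgf] at h
  rw [this, integral_const_mul, h, ← Real.exp_add]
  congr 1
  push_cast; ring

end Laws
-- Scalar channels and their output laws
section ScalarChannels

lemma lintegral_le_of_forall_le {X : Type*} [MeasurableSpace X] (ρ : Measure X)
    [IsProbabilityMeasure ρ] {f : X → ℝ≥0∞} {c : ℝ≥0∞} (h : ∀ w, f w ≤ c) :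
    ∫⁻ w, f w ∂ρ ≤ c := by
  calc ∫⁻ w, f w ∂ρ ≤ ∫⁻ _, c ∂ρ := lintegral_mono h
    _ = c := by simp

variable {S : Type*} [MeasurableSpace S] [DiscreteMeasurableSpace S]

/-- The channel with output in `{0, 1}` and success probability `p w` for the input `w`. -/
noncomputable def bernoulliKernel (p : S → I) : Kernel S ℝ where
  toFun w := bernoulliMeasure 1 0 (p w)
  measurable' := Measurable.of_discrete

/-- The channel that adds to `x w` a Gaussian noise of variance `v`. -/
noncomputable def gaussianKernel (x : S → ℝ) (v : ℝ≥0) : Kernel S ℝ where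
  toFun w := gaussianReal (x w) v
  measurable' := Measurable.of_discrete

lemma bernoulliKernel_apply (p : S → I) (w : S) :
    bernoulliKernel p w = bernoulliMeasure 1 0 (p w) := rfl

lemma gaussianKernel_apply (x : S → ℝ) (v : ℝ≥0) (w : S) :
    gaussianKernel x v w = gaussianReal (x w) v := rfl

instance (p : S → I) : IsMarkovKernel (bernoulliKernel p) :=
  ⟨fun w => by rw [bernoulliKernel_apply]; infer_instance⟩

instance (x : S → ℝ) (v : ℝ≥0) : IsMarkovKernel (gaussianKernel x v) :=
  ⟨fun w => by rw [gaussianKernel_apply]; infer_instance⟩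

variable (ρ : Measure S) [IsProbabilityMeasure ρ]

lemma bernoulliKernel_comp [Finite S] {p : S → I} {r : I} (hr : (r : ℝ) = ∫ w, (p w : ℝ) ∂ρ) :
    bernoulliKernel p ∘ₘ ρ = bernoulliMeasure 1 0 r := by
  refine Measure.ext_of_lintegral _ fun φ hφ => ?_
  rw [Measure.lintegral_bind (Kernel.aemeasurable _) hφ.aemeasurable]
  simp_rw [bernoulliKernel_apply, lintegral_bernoulliMeasure]
  rw [lintegral_add_left (.of_discrete), lintegral_mul_const _ (.of_discrete),
    lintegral_mul_const _ (.of_discrete), ← ofReal_integral_eq_lintegral_ofReal .of_finite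
      (.of_forall fun w => (p w).2.1), ← ofReal_integral_eq_lintegral_ofReal .of_finite
      (.of_forall fun w => sub_nonneg.2 (p w).2.2), integral_sub .of_finite .of_finite, ← hr]
  simp

lemma gaussianKernel_comp_eq_withDensity [Fintype S] (x : S → ℝ) (b : ℝ) :
    gaussianKernel x 1 ∘ₘ ρ = (gaussianReal b 1).withDensity fun y => ENNReal.ofReal
      (∑ w, ρ.real {w} * Real.exp ((x w - b) * (y - b) - (x w - b) ^ 2 / 2)) := by
  ext A hA
  rw [Measure.bind_apply hA (Kernel.aemeasurable _), withDensity_apply _ hA]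
  have h : ∀ w, gaussianKernel x 1 w A = ∫⁻ y in A, ENNReal.ofReal
      (Real.exp ((x w - b) * (y - b) - (x w - b) ^ 2 / 2)) ∂(gaussianReal b 1) := fun w => by
    rw [gaussianKernel_apply, gaussianReal_eq_withDensity _ b one_ne_zero, withDensity_apply _ hA]
    simp
  simp_rw [h]
  rw [lintegral_fintype, ← lintegral_congr fun y => (ENNReal.ofReal_sum_of_nonneg
    (fun w _ => by positivity)).symm, lintegral_finsetSum _ fun w _ => by fun_prop]
  refine Finset.sum_congr rfl fun w _ => ?_
  simp_rw [ENNReal.ofReal_mul measureReal_nonneg]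
  rw [lintegral_const_mul _ (by fun_prop), mul_comm, ofReal_measureReal]

lemma exp_sub_one_sub_le_sq {t : ℝ} (ht : |t| ≤ 1) : Real.exp t - 1 - t ≤ t ^ 2 := 
  (le_abs_self _).trans (Real.abs_exp_sub_one_sub_id_le ht)

/-- Bound the divergence by chi-square. Squaring the mixture density produces two independent
replicas `a`, `a'` of the centred signal, and the chi-square divergence is `E[exp(a a') - 1]`.
Centring kills the linear term, leaving at most `E[(a a')²] ≤ η⁴`. -/
lemma klDiv_gaussianKernel_comp_le [Finite S] {x : S → ℝ} {b η : ℝ} (hb : b = ∫ w, x w ∂ρ)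
    (hη : η ≤ 1) (hx : ∀ w, |x w - b| ≤ η) :
    klDiv (gaussianKernel x 1 ∘ₘ ρ) (gaussianReal b 1) ≤ ENNReal.ofReal (η ^ 4) := by
  have := Fintype.ofFinite S
  set a : S → ℝ := fun w => x w - b with ha
  set π : S → ℝ := fun w => ρ.real {w} with hπ
  have hπ0 : ∀ w, 0 ≤ π w := fun w => measureReal_nonneg
  have hπ1 : ∑ w, π w = 1 := by
    have := integral_fintype (μ := ρ) (f := fun _ : S => (1 : ℝ)) .of_finite
    simp only [integral_const, probReal_univ, smul_eq_mul, mul_one] at this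
    exact this.symm
  have hπa : ∑ w, π w * a w = 0 := by
    have := integral_fintype (μ := ρ) (f := a) .of_finite
    rw [integral_sub .of_finite .of_finite, ← hb] at this
    simpa using this.symm
  set g : S → ℝ → ℝ := fun w y => Real.exp (a w * (y - b) - a w ^ 2 / 2) with hg
  set f : ℝ → ℝ := fun y => ∑ w, π w * g w y with hf
  have hfm : Measurable f := by fun_prop
  have hf0 : ∀ y, 0 ≤ f y := fun y => Finset.sum_nonneg fun w _ => by positivity
  have hd : gaussianKernel x 1 ∘ₘ ρ
      = (gaussianReal b 1).withDensity fun y => ENNReal.ofReal (f y) :=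
    gaussianKernel_comp_eq_withDensity ρ x b
  have : IsFiniteMeasure ((gaussianReal b 1).withDensity fun y => ENNReal.ofReal (f y)) := by
    rw [← hd]; infer_instance
  have hexp : ∀ y, (f y - 1) ^ 2
      = ∑ w, ∑ w', π w * π w' * (g w y * g w' y - g w y - g w' y + 1) := fun y => by
    have : f y - 1 = ∑ w, π w * (g w y - 1) := by
      simp_rw [mul_sub, mul_one, Finset.sum_sub_distrib, hπ1, hf]
    rw [this, sq, Finset.sum_mul_sum]
    refine Finset.sum_congr rfl fun w _ => Finset.sum_congr rfl fun w' _ => by ring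
  have hgi : ∀ w, Integrable (g w) (gaussianReal b 1) := fun w => integrable_exp_gaussianReal _ _ _
  have hgg : ∀ w w', (fun y => g w y * g w' y)
      = fun y => Real.exp ((a w + a w') * (y - b) - (a w ^ 2 + a w' ^ 2) / 2) := fun w w' => by
    ext y; simp only [hg]; rw [← Real.exp_add]; ring_nf
  have hggi : ∀ w w', Integrable (fun y => g w y * g w' y) (gaussianReal b 1) := fun w w' => by
    rw [hgg]; exact integrable_exp_gaussianReal _ _ _
  have hti : ∀ w w', Integrable (fun y => g w y * g w' y - g w y - g w' y + 1)
      (gaussianReal b 1) := fun w w' =>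
    (((hggi w w').sub (hgi w)).sub (hgi w')).add (integrable_const _)
  have hg1 : ∀ w, ∫ y, g w y ∂(gaussianReal b 1) = 1 := fun w => by
    simp only [hg]; rw [integral_exp_gaussianReal, sub_self, Real.exp_zero]
  have ht : ∀ w w', ∫ y, (g w y * g w' y - g w y - g w' y + 1) ∂(gaussianReal b 1)
      = Real.exp (a w * a w') - 1 := fun w w' => by
    have h1 := integral_add (((hggi w w').sub (hgi w)).sub (hgi w')) (integrable_const (1 : ℝ))
    have h2 := integral_sub ((hggi w w').sub (hgi w)) (hgi w')
    have h3 := integral_sub (hggi w w') (hgi w)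
    simp only [Pi.sub_apply] at h1 h2 h3
    rw [h1, h2, h3, hg1, hg1, hgg, integral_exp_gaussianReal]
    have : (a w + a w') ^ 2 / 2 - (a w ^ 2 + a w' ^ 2) / 2 = a w * a w' := by ring
    rw [this]; simp
  have hsi : Integrable (fun y => (f y - 1) ^ 2) (gaussianReal b 1) := by
    simp_rw [hexp]
    exact integrable_finsetSum _ fun w _ => integrable_finsetSum _ fun w' _ =>
      (hti w w').const_mul _
  have hI : ∫ y, (f y - 1) ^ 2 ∂(gaussianReal b 1)
      = ∑ w, ∑ w', π w * π w' * (Real.exp (a w * a w') - 1) := by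
    simp_rw [hexp]
    rw [integral_finsetSum _ fun w _ => integrable_finsetSum _ fun w' _ => (hti w w').const_mul _]
    refine Finset.sum_congr rfl fun w _ => ?_
    rw [integral_finsetSum _ fun w' _ => (hti w w').const_mul _]
    refine Finset.sum_congr rfl fun w' _ => ?_
    rw [integral_const_mul, ht]
  have hle : ∫ y, (f y - 1) ^ 2 ∂(gaussianReal b 1) ≤ η ^ 4 := by
    -- The linear term of the exponential factorises over the replicas and vanishes because `b` is
    -- the mean.
    have hz : ∑ w, ∑ w', π w * π w' * (a w * a w') = 0 := by
      have : ∀ w w', π w * π w' * (a w * a w') = (π w * a w) * (π w' * a w') := fun _ _ => by ring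
      simp_rw [this]
      rw [← Finset.sum_mul_sum, hπa, zero_mul]
    calc ∫ y, (f y - 1) ^ 2 ∂(gaussianReal b 1)
        = ∑ w, ∑ w', π w * π w' * (Real.exp (a w * a w') - 1 - a w * a w') := by
          rw [hI, ← sub_zero (∑ w, _), ← hz, ← Finset.sum_sub_distrib]
          refine Finset.sum_congr rfl fun w _ => ?_
          rw [← Finset.sum_sub_distrib]
          exact Finset.sum_congr rfl fun w' _ => by ring
      _ ≤ ∑ w, ∑ w', π w * π w' * η ^ 4 := by
          refine Finset.sum_le_sum fun w _ => Finset.sum_le_sum fun w' _ => ?_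
          refine mul_le_mul_of_nonneg_left ?_ (mul_nonneg (hπ0 _) (hπ0 _))
          have h0 : 0 ≤ η := (abs_nonneg _).trans (hx w)
          have h2 : |a w * a w'| ≤ η ^ 2 := by
            rw [abs_mul, sq]; exact mul_le_mul (hx w) (hx w') (abs_nonneg _) h0
          refine (exp_sub_one_sub_le_sq (h2.trans (pow_le_one₀ h0 hη))).trans ?_
          rw [← sq_abs, show η ^ 4 = (η ^ 2) ^ 2 by ring]
          gcongr
      _ = η ^ 4 := by
          simp_rw [← Finset.sum_mul, ← Finset.mul_sum, hπ1, mul_one]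
          rw [hπ1, one_mul]
  rw [hd, klDiv_withDensity_ofReal _ hfm hf0]
  calc ∫⁻ y, ENNReal.ofReal (klFun (f y)) ∂(gaussianReal b 1)
      ≤ ∫⁻ y, ENNReal.ofReal ((f y - 1) ^ 2) ∂(gaussianReal b 1) :=
        lintegral_mono fun y => ENNReal.ofReal_le_ofReal (klFun_le_sq (hf0 y))
    _ = ENNReal.ofReal (∫ y, (f y - 1) ^ 2 ∂(gaussianReal b 1)) :=
        (ofReal_integral_eq_lintegral_ofReal hsi (.of_forall fun y => sq_nonneg _)).symm
    _ ≤ _ := ENNReal.ofReal_le_ofReal hle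

variable [StandardBorelSpace S] [Nonempty S]

lemma channelInfo_gaussianKernel_le (x : S → ℝ) {v : ℝ≥0} (hv : v ≠ 0) (b : ℝ) :
    channelInfo ρ (gaussianKernel x v)
      ≤ ∫⁻ w, ENNReal.ofReal ((x w - b) ^ 2 / (2 * v)) ∂ρ := by
  refine (channelInfo_le_lintegral ρ _ (gaussianReal b v)).trans (le_of_eq ?_)
  simp_rw [gaussianKernel_apply, klDiv_gaussianReal _ _ hv]

lemma channelInfo_gaussianKernel_le_sq {x : S → ℝ} {v : ℝ≥0} (hv : v ≠ 0) {ε : ℝ}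
    (hx : ∀ w, |x w| ≤ ε) :
    channelInfo ρ (gaussianKernel x v) ≤ ENNReal.ofReal (ε ^ 2 / (2 * v)) := by
  refine (channelInfo_gaussianKernel_le ρ x hv 0).trans (lintegral_le_of_forall_le ρ fun w => ?_)
  rw [sub_zero, ← sq_abs]
  have := hx w
  gcongr

/-- Take Bernoulli(`q`) as reference output law: the normalisation by `s` makes the chi-square
divergence exactly `x²`. -/
lemma channelInfo_bernoulliKernel_le_sq {p : S → I} {x : S → ℝ} {q s ε : ℝ}
    (hq : q ∈ Set.Ioo (0 : ℝ) 1) (hs0 : 0 < s) (hs : s ^ 2 = q * (1 - q))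
    (hp : ∀ w, (p w : ℝ) = q + s * x w) (hx : ∀ w, |x w| ≤ ε) :
    channelInfo ρ (bernoulliKernel p) ≤ ENNReal.ofReal (ε ^ 2) := by
  let q' : I := ⟨q, hq.1.le, hq.2.le⟩
  refine (channelInfo_le_lintegral ρ _ (bernoulliMeasure 1 0 q')).trans
    (lintegral_le_of_forall_le ρ fun w => ?_)
  rw [bernoulliKernel_apply, klDiv_bernoulliMeasure _ _ hq]
  refine ENNReal.ofReal_le_ofReal ((klBern_le (p w).2 hq).trans ?_)
  have h1 : (p w : ℝ) - q = s * x w := by rw [hp]; ring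
  change ((p w : ℝ) - q) ^ 2 / (q * (1 - q)) ≤ _
  rw [h1, mul_pow, hs, ← hs, mul_div_cancel_left₀ _ (by positivity), ← sq_abs]
  have := hx w
  gcongr

end ScalarChannels
-- Both scalar informations are half the prior variance
section ScalarComparison

lemma abs_integral_le_of_forall_le {X : Type*} [MeasurableSpace X] (ρ : Measure X)
    [IsProbabilityMeasure ρ] {x : X → ℝ} {ε : ℝ} (hx : ∀ w, |x w| ≤ ε) :
    |∫ w, x w ∂ρ| ≤ ε := by
  have h := norm_integral_le_of_norm_le_const (μ := ρ) (f := x) (C := ε) (.of_forall hx)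
  simpa using h

variable {S : Type*} [MeasurableSpace S] [DiscreteMeasurableSpace S]
  [StandardBorelSpace S] [Finite S] (ρ : Measure S) [IsProbabilityMeasure ρ]

variable {p : S → I} {x : S → ℝ} {q s ε : ℝ}

/-- A mixture of Bernoulli laws is the Bernoulli law with the mean parameter `q + s b`, so the
information is exactly an average of `klBern` and the expansion applies pointwise. -/
lemma channelInfo_bernoulliKernel_near_variance
    (hq : q ∈ Set.Ioo (0 : ℝ) 1) (hs0 : 0 < s) (hs : s ^ 2 = q * (1 - q))
    (hp : ∀ w, (p w : ℝ) = q + s * x w) (hx : ∀ w, |x w| ≤ ε) (hε : ε ≤ s / 8) :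
    channelInfo ρ (bernoulliKernel p) ≤
        ∫⁻ w, ENNReal.ofReal ((x w - ∫ w', x w' ∂ρ) ^ 2 / 2) ∂ρ
          + ENNReal.ofReal (200 * (ε ^ 3 / s)) ∧
      ∫⁻ w, ENNReal.ofReal ((x w - ∫ w', x w' ∂ρ) ^ 2 / 2) ∂ρ ≤
        channelInfo ρ (bernoulliKernel p) + ENNReal.ofReal (200 * (ε ^ 3 / s)) := by
  set b := ∫ w', x w' ∂ρ with hb
  have hbε : |b| ≤ ε := abs_integral_le_of_forall_le ρ hx
  have hr : ∫ w, (p w : ℝ) ∂ρ = q + s * b := by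
    simp_rw [hp]
    rw [integral_add .of_finite .of_finite, integral_const_mul, ← hb]
    simp
  have hr01 : q + s * b ∈ Set.Ioo (0 : ℝ) 1 := by
    have h1 : |s * b| ≤ q * (1 - q) / 8 := by
      rw [abs_mul, abs_of_pos hs0, ← hs]; nlinarith [abs_nonneg b]
    have h2 := abs_le.1 h1
    have := hq.1; have := hq.2
    constructor <;> nlinarith
  let r : I := ⟨q + s * b, hr01.1.le, hr01.2.le⟩
  have hI : channelInfo ρ (bernoulliKernel p)
      = ∫⁻ w, ENNReal.ofReal (klBern (q + s * x w) (q + s * b)) ∂ρ := by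
    rw [channelInfo_eq_lintegral, bernoulliKernel_comp ρ (r := r) hr.symm]
    refine lintegral_congr fun w => ?_
    rw [bernoulliKernel_apply, klDiv_bernoulliMeasure _ _ hr01, hp]
  have hpt : ∀ w, |klBern (q + s * x w) (q + s * b) - (x w - b) ^ 2 / 2| ≤ 200 * (ε ^ 3 / s) :=
    fun w => abs_klBern_sub_le hq hs0 hs (hx w) hbε hε
  rw [hI]
  have hε0 : 0 ≤ ε := (abs_nonneg _).trans hbε
  have hc : ∀ f : S → ℝ≥0∞, ∫⁻ w, f w ∂ρ + ENNReal.ofReal (200 * (ε ^ 3 / s))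
      = ∫⁻ w, (f w + ENNReal.ofReal (200 * (ε ^ 3 / s))) ∂ρ := fun f => by
    rw [lintegral_add_right _ measurable_const]; simp
  constructor <;> rw [hc] <;> refine lintegral_mono fun w => ?_
  · rw [← ENNReal.ofReal_add (by positivity) (by positivity)]
    exact ENNReal.ofReal_le_ofReal (by linarith [(abs_le.1 (hpt w)).2])
  · refine le_trans (ENNReal.ofReal_le_ofReal ?_) ENNReal.ofReal_add_le
    linarith [(abs_le.1 (hpt w)).1]

variable [Nonempty S] in
-- With reference law `N(b, 1)` the mean divergence is exactly half the variance. By the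
-- compensation identity it exceeds the information by the divergence of the output mixture from
-- that Gaussian.
lemma channelInfo_gaussianKernel_near_variance (hx : ∀ w, |x w| ≤ ε) (hε : 2 * ε ≤ 1) :
    channelInfo ρ (gaussianKernel x 1) ≤
        ∫⁻ w, ENNReal.ofReal ((x w - ∫ w', x w' ∂ρ) ^ 2 / 2) ∂ρ ∧
      ∫⁻ w, ENNReal.ofReal ((x w - ∫ w', x w' ∂ρ) ^ 2 / 2) ∂ρ ≤
        channelInfo ρ (gaussianKernel x 1) + ENNReal.ofReal ((2 * ε) ^ 4) := by
  set b := ∫ w', x w' ∂ρ with hb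
  have hbε : |b| ≤ ε := abs_integral_le_of_forall_le ρ hx
  have hxb : ∀ w, |x w - b| ≤ 2 * ε := fun w => (abs_sub _ _).trans (by linarith [hx w])
  constructor
  · simpa using channelInfo_gaussianKernel_le ρ x one_ne_zero b
  · have h := lintegral_klDiv_eq_add ρ (gaussianKernel x 1) (gaussianReal b 1)
    simp_rw [gaussianKernel_apply, klDiv_gaussianReal _ _ one_ne_zero] at h
    rw [NNReal.coe_one, mul_one] at h
    rw [h, add_comm]
    exact add_le_add_right (klDiv_gaussianKernel_comp_le ρ hb hε hxb) _

variable [Nonempty S] in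
/-- Universality for a single edge: uniformly in the prior, the Bernoulli channel and the Gaussian
channel carry the same information about a small signal up to third order. -/
lemma channelInfo_bernoulliKernel_gaussianKernel
    (hq : q ∈ Set.Ioo (0 : ℝ) 1) (hs0 : 0 < s) (hs : s ^ 2 = q * (1 - q))
    (hp : ∀ w, (p w : ℝ) = q + s * x w) (hx : ∀ w, |x w| ≤ ε) :
    channelInfo ρ (bernoulliKernel p) ≤
        channelInfo ρ (gaussianKernel x 1) + ENNReal.ofReal (201 * (ε ^ 3 / s)) ∧
      channelInfo ρ (gaussianKernel x 1) ≤
        channelInfo ρ (bernoulliKernel p) + ENNReal.ofReal (201 * (ε ^ 3 / s)) := by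
  have hε0 : 0 ≤ ε := (abs_nonneg _).trans (hx (Classical.arbitrary S))
  have hpos : 0 ≤ ε ^ 3 / s := by positivity
  -- For `ε ≤ s/8` both informations are compared with half the variance, the Gaussian error `(2ε)⁴`
  -- fitting into one further `ε³/s`. For `ε > s/8` each is at most `ε² < 8ε³/s`.
  rcases le_or_gt ε (s / 8) with hε | hε
  · have hs1 : s ≤ 1 / 2 := by nlinarith [sq_nonneg (q - 1 / 2)]
    have h4 : (2 * ε) ^ 4 ≤ ε ^ 3 / s := by
      rw [le_div_iff₀ hs0]
      nlinarith [pow_nonneg hε0 3, mul_nonneg (pow_nonneg hε0 3) hε0,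
        mul_le_mul_of_nonneg_left (show 16 * ε * s ≤ 1 by nlinarith) (pow_nonneg hε0 3)]
    obtain ⟨b1, b2⟩ := channelInfo_bernoulliKernel_near_variance ρ hq hs0 hs hp hx hε
    obtain ⟨g1, g2⟩ := channelInfo_gaussianKernel_near_variance ρ hx (by linarith)
    constructor
    · calc _ ≤ _ := b1
        _ ≤ channelInfo ρ (gaussianKernel x 1) + ENNReal.ofReal ((2 * ε) ^ 4)
            + ENNReal.ofReal (200 * (ε ^ 3 / s)) := by gcongr
        _ = channelInfo ρ (gaussianKernel x 1)
            + ENNReal.ofReal ((2 * ε) ^ 4 + 200 * (ε ^ 3 / s)) := by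
          rw [add_assoc, ENNReal.ofReal_add (by positivity) (by positivity)]
        _ ≤ _ := by gcongr; linarith
    · refine g1.trans (b2.trans ?_)
      gcongr
      linarith
  · have h8 : ε ^ 2 ≤ 201 * (ε ^ 3 / s) := by
      rw [← mul_div_assoc, le_div_iff₀ hs0]
      nlinarith [mul_le_mul_of_nonneg_left (show s ≤ 201 * ε by linarith) (sq_nonneg ε)]
    constructor
    · refine (channelInfo_bernoulliKernel_le_sq ρ hq hs0 hs hp hx).trans (le_add_left ?_)
      exact ENNReal.ofReal_le_ofReal h8
    · refine (channelInfo_gaussianKernel_le_sq ρ one_ne_zero hx).trans (le_add_left ?_)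
      refine ENNReal.ofReal_le_ofReal ?_
      rw [NNReal.coe_one]
      linarith [sq_nonneg ε]

end ScalarComparison
-- From mutual information to channels
section Encoding

variable {Ω E F E' F' : Type*} [MeasurableSpace Ω] [MeasurableSpace E] [MeasurableSpace F]
  [MeasurableSpace E'] [MeasurableSpace F'] {P : Measure Ω}

lemma mutualInfo_congr {X X' : Ω → E} {Y Y' : Ω → F} (hX : X =ᵐ[P] X') (hY : Y =ᵐ[P] Y') :
    mutualInfo X Y P = mutualInfo X' Y' P := by
  rw [mutualInfo, mutualInfo, Measure.map_congr hX, Measure.map_congr hY,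
    Measure.map_congr (hX.prodMk hY)]

variable [IsProbabilityMeasure P]

lemma mutualInfo_comp_le {X : Ω → E} {Y : Ω → F} (hX : Measurable X) (hY : Measurable Y)
    {f : E → E'} {g : F → F'} (hf : Measurable f) (hg : Measurable g) :
    mutualInfo (fun ω => f (X ω)) (fun ω => g (Y ω)) P ≤ mutualInfo X Y P := by
  have := Measure.isProbabilityMeasure_map (μ := P) hX.aemeasurable
  have := Measure.isProbabilityMeasure_map (μ := P) hY.aemeasurable
  have h := klDiv_map_le (P.map fun ω => (X ω, Y ω)) ((P.map X).prod (P.map Y))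
    (g := Prod.map f g) (by fun_prop)
  rw [Measure.map_map (by fun_prop) (by fun_prop), ← Measure.map_prod_map _ _ hf hg,
    Measure.map_map hf hX, Measure.map_map hg hY] at h
  exact h

/-- Data processing in both directions; decoding needs to succeed only almost surely. -/
lemma mutualInfo_eq_of_encoding {X : Ω → E} {Y : Ω → F} (hX : Measurable X) (hY : Measurable Y)
    {f : E → E'} {f' : E' → E} (hf : Measurable f) (hf' : Measurable f')
    (hXf : ∀ᵐ ω ∂P, f' (f (X ω)) = X ω)
    {g : F → F'} {g' : F' → F} (hg : Measurable g) (hg' : Measurable g')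
    (hYg : ∀ᵐ ω ∂P, g' (g (Y ω)) = Y ω) :
    mutualInfo X Y P = mutualInfo (fun ω => f (X ω)) (fun ω => g (Y ω)) P := by
  refine le_antisymm ?_ (mutualInfo_comp_le hX hY hf hg)
  rw [← mutualInfo_congr hXf hYg]
  exact mutualInfo_comp_le (hf.comp hX) (hg.comp hY) hf' hg'

variable {S : Type*} [MeasurableSpace S] [Countable S] [MeasurableSingletonClass S]

/-- For a countable input the conditional laws on atoms determine the joint law; `k` is arbitrary at
values of probability zero. -/
lemma mutualInfo_eq_channelInfo {X : Ω → S} {Y : Ω → F} (hX : Measurable X) (hY : Measurable Y)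
    (k : Kernel S F) [IsMarkovKernel k]
    (hk : ∀ w, P (X ⁻¹' {w}) ≠ 0 → (P[|X ⁻¹' {w}]).map Y = k w) :
    mutualInfo X Y P = channelInfo (P.map X) k := by
  have := Measure.isProbabilityMeasure_map (μ := P) hX.aemeasurable
  have hm : ∀ w t, MeasurableSet t → P (X ⁻¹' {w} ∩ Y ⁻¹' t) = P (X ⁻¹' {w}) * k w t := by
    intro w t ht
    by_cases h0 : P (X ⁻¹' {w}) = 0
    · rw [h0, zero_mul]
      exact measure_mono_null Set.inter_subset_left h0
    · rw [← cond_mul_eq_inter (hX (measurableSet_singleton w)), ← hk w h0,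
        Measure.map_apply hY ht, mul_comm]
  have hj : P.map (fun ω => (X ω, Y ω)) = (P.map X) ⊗ₘ k := by
    have := Measure.isProbabilityMeasure_map (μ := P) (hX.prodMk hY).aemeasurable
    refine Measure.ext_prod fun {s t} hs ht => ?_
    rw [Measure.compProd_apply_prod hs ht, ← withDensity_apply _ hs,
      Measure.map_apply (hX.prodMk hY) (hs.prod ht)]
    have he : (P.restrict (Y ⁻¹' t)).map X = (P.map X).withDensity fun w => k w t := by
      refine Measure.ext_of_singleton fun w => ?_
      rw [Measure.map_apply hX (measurableSet_singleton w),
        Measure.restrict_apply (hX (measurableSet_singleton w)), hm w t ht,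
        withDensity_apply _ (measurableSet_singleton w), lintegral_singleton,
        Measure.map_apply hX (measurableSet_singleton w), mul_comm]
    rw [← he, Measure.map_apply hX hs, Measure.restrict_apply (hX hs)]
    rfl
  have hY' : P.map Y = k ∘ₘ (P.map X) := by
    rw [← Measure.snd_compProd, ← hj, Measure.snd_map_prodMk hX]
  rw [mutualInfo, hj, hY', channelInfo]

end Encoding

/-! ### Reduction to a finite input alphabet -/

section Atoms

variable {Ω M : Type*} [MeasurableSpace Ω] {P : Measure Ω}

/-- The values that `W` takes with positive probability. -/
def atoms (W : Ω → M) (P : Measure Ω) : Set M := {w | P (W ⁻¹' {w}) ≠ 0}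

lemma ae_mem_atoms_of_finite {W : Ω → M} {A : Set M} (hA : A.Finite)
    (hWA : ∀ᵐ ω ∂P, W ω ∈ A) : ∀ᵐ ω ∂P, W ω ∈ atoms W P := by
  have h : P (⋃ w ∈ A \ atoms W P, W ⁻¹' {w}) = 0 := by
    rw [measure_biUnion_null_iff (hA.subset Set.sdiff_subset).countable]
    intro w hw
    simpa [atoms] using hw.2
  filter_upwards [hWA, measure_eq_zero_iff_ae_notMem.1 h] with ω h1 h2
  by_contra h3
  exact h2 (Set.mem_biUnion (⟨h1, h3⟩ : W ω ∈ A \ atoms W P) rfl)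

lemma atoms_subset_of_finite {W : Ω → M} {A : Set M}
    (hWA : ∀ᵐ ω ∂P, W ω ∈ A) : atoms W P ⊆ A := by
  intro w hw
  by_contra h
  refine hw (measure_mono_null ?_ (ae_iff.1 hWA))
  rintro ω rfl
  exact h

variable [MeasurableSpace M] [MeasurableSingletonClass M] [IsProbabilityMeasure P]

/-- Replaces the matrix-valued input by one in a finite type, on which every kernel is measurable.
The encoder extends the identity of the atoms to all of `M`, and it leaves conditioning on an atom
unchanged. -/
lemma exists_atom_encoding {W : Ω → M} {A : Set M} (hA : A.Finite)
    (hWA : ∀ᵐ ω ∂P, W ω ∈ A) :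
    Nonempty (atoms W P) ∧ ∃ f : M → atoms W P, Measurable f ∧
      (∀ᵐ ω ∂P, (f (W ω) : M) = W ω) ∧
      ∀ a : atoms W P, P[|(fun ω => f (W ω)) ⁻¹' {a}] = P[|W ⁻¹' {(a : M)}] := by
  have hmem := ae_mem_atoms_of_finite hA hWA
  obtain ⟨ω₀, h₀⟩ := hmem.exists
  have hne : Nonempty (atoms W P) := ⟨⟨_, h₀⟩⟩
  have hm : MeasurableSet (atoms W P) := (hA.subset (atoms_subset_of_finite hWA)).measurableSet
  obtain ⟨f, hf, hfi⟩ := (MeasurableEmbedding.subtype_coe hm).exists_measurable_extend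
    (measurable_id (α := atoms W P)) (fun _ => hne)
  have hfa : ∀ a : atoms W P, f a = a := fun a => congrFun hfi a
  have hval : ∀ᵐ ω ∂P, (f (W ω) : M) = W ω := by
    filter_upwards [hmem] with ω hω
    rw [hfa ⟨W ω, hω⟩]
  refine ⟨hne, f, hf, hval, fun a => ?_⟩
  have hs : (fun ω => f (W ω)) ⁻¹' {a} =ᵐ[P] W ⁻¹' {(a : M)} := by
    filter_upwards [hval] with ω hω
    refine propext ⟨fun h => ?_, fun h => ?_⟩
    · change f (W ω) = a at h
      change W ω = a
      rw [← hω, h]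
    · change W ω = a at h
      change f (W ω) = a
      rw [h, hfa]
  rw [ProbabilityTheory.cond, ProbabilityTheory.cond, measure_congr hs, Measure.restrict_congr_set hs]

end Atoms
-- Symmetric matrices as families of upper entries
section Matrices

variable {n : ℕ}

/-- The positions on and above the diagonal. -/
abbrev UpperIndex (n : ℕ) : Type := {e : Fin n × Fin n // e.1 ≤ e.2}

/-- The entries of a matrix on and above the diagonal. -/
def upperEntries (m : Fin n → Fin n → ℝ) : UpperIndex n → ℝ := fun e => m e.1.1 e.1.2

/-- The symmetric matrix with the given entries on and above the diagonal. -/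
def symmetricOf (y : UpperIndex n → ℝ) : Fin n → Fin n → ℝ :=
  fun i j => y ⟨(min i j, max i j), min_le_max⟩

lemma measurable_upperEntries : Measurable (upperEntries (n := n)) := by
  unfold upperEntries; fun_prop

lemma measurable_symmetricOf : Measurable (symmetricOf (n := n)) := by
  unfold symmetricOf; fun_prop

lemma symmetricOf_upperEntries {m : Fin n → Fin n → ℝ} (hm : ∀ i j, m i j = m j i) :
    symmetricOf (upperEntries m) = m := by
  ext i j
  rcases le_total i j with h | h
  · simp [symmetricOf, upperEntries, h]
  · simp [symmetricOf, upperEntries, h, hm i j]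

lemma sum_upperIndex_le (a b : ℝ≥0∞) :
    ∑ e : UpperIndex n, (if e.1.1 < e.1.2 then a else b) ≤ n ^ 2 * a + n * b := by
  let F : Fin n × Fin n → ℝ≥0∞ := fun p => a + if p.1 = p.2 then b else 0
  calc ∑ e : UpperIndex n, (if e.1.1 < e.1.2 then a else b) ≤ ∑ e : UpperIndex n, F e.1 := by
        refine Finset.sum_le_sum fun e _ => ?_
        split_ifs with h
        · exact le_self_add
        · simp only [F, if_pos (le_antisymm e.2 (not_lt.1 h))]
          exact le_add_self
    _ ≤ ∑ p : Fin n × Fin n, F p := by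
        rw [← Fintype.sum_subtype_add_sum_subtype (fun p : Fin n × Fin n => p.1 ≤ p.2) F]
        exact le_self_add
    _ = _ := by
        simp only [F, Finset.sum_add_distrib, Fintype.sum_prod_type]
        simp [sq, mul_assoc]

end Matrices

/-! ### Conditional laws of the two observations given the signal -/

section ConditionalLaws

variable {Ω : Type*} [MeasurableSpace Ω] {P : Measure Ω} {n : ℕ}
  {W G ξ : Ω → Fin n → Fin n → ℝ}

lemma IsGaussianWigner.map_upperEntries (hξ : IsGaussianWigner ξ P) :
    P.map (fun ω => upperEntries (ξ ω)) =
      Measure.pi fun e : UpperIndex n => gaussianReal 0 (if e.1.1 < e.1.2 then 1 else 2) := by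
  have hm : ∀ i j, Measurable fun ω => ξ ω i j := fun i j =>
    (measurable_pi_apply j).comp ((measurable_pi_apply i).comp hξ.measurable)
  refine (hξ.indep.map_fun_eq_pi_map fun e => (hm _ _).aemeasurable).trans ?_
  congr 1
  ext1 e
  split_ifs with h
  · exact (hξ.offDiag _ _ h).map_eq
  · have he : e.1.1 = e.1.2 := le_antisymm e.2 (not_lt.1 h)
    rw [← he]
    exact (hξ.diag _).map_eq

variable [IsProbabilityMeasure P]

lemma mutualInfo_eq_channelInfo_upper (hW : Measurable W) (hG : Measurable G)
    (hGs : ∀ᵐ ω ∂P, ∀ i j, G ω i j = G ω j i)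
    {f : (Fin n → Fin n → ℝ) → atoms W P} (hf : Measurable f)
    (hfW : ∀ᵐ ω ∂P, (f (W ω) : Fin n → Fin n → ℝ) = W ω)
    (hfc : ∀ a : atoms W P, P[|(fun ω => f (W ω)) ⁻¹' {a}] = P[|W ⁻¹' {a.1}])
    [Countable (atoms W P)]
    (k : Kernel (atoms W P) (UpperIndex n → ℝ)) [IsMarkovKernel k]
    (hk : ∀ a : atoms W P, (P[|W ⁻¹' {a.1}]).map (fun ω => upperEntries (G ω)) = k a) :
    mutualInfo W G P = channelInfo (P.map fun ω => f (W ω)) k := by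
  rw [mutualInfo_eq_of_encoding hW hG hf measurable_subtype_coe hfW measurable_upperEntries
    measurable_symmetricOf (by
      filter_upwards [hGs] with ω hω
      exact symmetricOf_upperEntries hω)]
  refine mutualInfo_eq_channelInfo (hf.comp hW) (measurable_upperEntries.comp hG) k fun a _ => ?_
  exact (congrArg (Measure.map _) (hfc a)).trans (hk a)

lemma IsGaussianWigner.cond_map_upperEntries_add (hξ : IsGaussianWigner ξ P) (hW : Measurable W)
    (hWξ : IndepFun W ξ P) {w : Fin n → Fin n → ℝ} (hw : P (W ⁻¹' {w}) ≠ 0) :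
    (P[|W ⁻¹' {w}]).map (fun ω => upperEntries (W ω + ξ ω)) =
      Measure.pi fun e : UpperIndex n =>
        gaussianReal (w e.1.1 e.1.2) (if e.1.1 < e.1.2 then 1 else 2) := by
  have hs : MeasurableSet (W ⁻¹' {w}) := hW (measurableSet_singleton w)
  have hu : Measurable fun ω => upperEntries (ξ ω) := measurable_upperEntries.comp hξ.measurable
  -- Conditioning on the signal does not affect the independent noise, so what remains is a
  -- translation by `w`.
  have h1 : (P[|W ⁻¹' {w}]).map (fun ω => upperEntries (ξ ω))
      = P.map (fun ω => upperEntries (ξ ω)) := by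
    ext t ht
    rw [Measure.map_apply hu ht, Measure.map_apply hu ht, cond_apply hs]
    have h := hWξ.measure_inter_preimage_eq_mul {w} (upperEntries ⁻¹' t)
      (measurableSet_singleton w) (measurable_upperEntries ht)
    rw [Set.preimage_preimage] at h
    change _ * P (W ⁻¹' {w} ∩ (fun ω => upperEntries (ξ ω)) ⁻¹' t) = _
    rw [h, ← mul_assoc, ENNReal.inv_mul_cancel hw (measure_ne_top _ _), one_mul]
  have h2 : (P[|W ⁻¹' {w}]).map (fun ω => upperEntries (W ω + ξ ω))
      = ((P[|W ⁻¹' {w}]).map (fun ω => upperEntries (ξ ω))).map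
          (fun y e => w e.1.1 e.1.2 + y e) := by
    rw [Measure.map_map (by fun_prop) hu]
    refine Measure.map_congr ?_
    filter_upwards [ae_cond_mem hs] with ω hω
    have : W ω = w := hω
    ext e
    simp [upperEntries, this]
  rw [h2, h1, hξ.map_upperEntries]
  refine (Measure.pi_map_pi (f := fun (e : UpperIndex n) y => w e.1.1 e.1.2 + y)
    fun e => by fun_prop).trans ?_
  simp_rw [gaussianReal_map_const_add, zero_add]

/-- Checked on boxes. If every diagonal side contains `0`, the diagonal imposes no constraint almost
surely and independence of the edges gives the product. If one misses `0`, both sides vanish. -/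
lemma IsBernoulliGraph.cond_map_upperEntries {d : ℝ} (hG : IsBernoulliGraph d W G P)
    {w : Fin n → Fin n → ℝ} (hw : P (W ⁻¹' {w}) ≠ 0) (p : UpperIndex n → I)
    (hp : ∀ e : UpperIndex n, e.1.1 < e.1.2 → (p e : ℝ) = edgeProb n d (w e.1.1 e.1.2)) :
    (P[|W ⁻¹' {w}]).map (fun ω => upperEntries (G ω)) =
      Measure.pi fun e : UpperIndex n =>
        if e.1.1 < e.1.2 then bernoulliMeasure (1 : ℝ) 0 (p e) else Measure.dirac 0 := by
  set Q := P[|W ⁻¹' {w}] with hQ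
  have : IsProbabilityMeasure Q := cond_isProbabilityMeasure hw
  have hm : ∀ i j, Measurable fun ω => G ω i j := fun i j =>
    (measurable_pi_apply j).comp ((measurable_pi_apply i).comp hG.measurable)
  have hdiag : ∀ᵐ ω ∂Q, ∀ i, G ω i i = 0 := cond_absolutelyContinuous.ae_le hG.diag
  have hlaw : ∀ e : UpperIndex n, e.1.1 < e.1.2 →
      Q.map (fun ω => G ω e.1.1 e.1.2) = bernoulliMeasure (1 : ℝ) 0 (p e) := fun e he => by
    obtain ⟨p', hp', hl⟩ := hG.law w hw _ _ he
    rw [hl.map_eq]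
    congr 1
    exact Subtype.ext (hp'.trans (hp e he).symm)
  have hpr : ∀ e : UpperIndex n, IsProbabilityMeasure
      (if e.1.1 < e.1.2 then bernoulliMeasure (1 : ℝ) 0 (p e) else Measure.dirac 0) := fun e => by
    split_ifs <;> infer_instance
  symm
  refine Measure.pi_eq fun s hs => ?_
  have hu : Measurable fun ω => upperEntries (G ω) := measurable_upperEntries.comp hG.measurable
  rw [Measure.map_apply hu (.univ_pi hs)]
  by_cases hD : ∀ i, (0 : ℝ) ∈ s ⟨(i, i), le_rfl⟩
  · have h1 : (fun ω => upperEntries (G ω)) ⁻¹' (Set.univ.pi s) =ᵐ[Q]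
        ⋂ e ∈ (Finset.univ : Finset {e : Fin n × Fin n // e.1 < e.2}),
          (fun ω => G ω e.1.1 e.1.2) ⁻¹' s ⟨e.1, e.2.le⟩ := by
      filter_upwards [hdiag] with ω hω
      refine propext ⟨fun h => ?_, fun h => ?_⟩
      · refine Set.mem_iInter₂.2 fun e _ => ?_
        exact h ⟨e.1, e.2.le⟩ trivial
      · rintro ⟨⟨i, j⟩, hij⟩ -
        rcases hij.lt_or_eq with hlt | heq
        · exact Set.mem_iInter₂.1 h ⟨(i, j), hlt⟩ (Finset.mem_univ _)
        · change i = j at heq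
          subst heq
          change G ω i i ∈ _
          rw [hω i]
          exact hD i
    rw [measure_congr h1, (hG.indep w hw).measure_inter_preimage_eq_mul Finset.univ
      (sets := fun e => s ⟨e.1, e.2.le⟩) fun e _ => hs _]
    refine Fintype.prod_of_injective (fun e : {e : Fin n × Fin n // e.1 < e.2} =>
      (⟨e.1, e.2.le⟩ : UpperIndex n)) (fun a b hab => Subtype.ext (congrArg (fun e => e.1) hab))
      _ _ ?_ ?_
    · rintro ⟨⟨i, j⟩, hij⟩ hr
      have hlt : ¬ i < j := fun h => hr ⟨⟨(i, j), h⟩, rfl⟩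
      obtain rfl : i = j := le_antisymm hij (not_lt.1 hlt)
      rw [if_neg hlt, Measure.dirac_apply' _ (hs _), Set.indicator_of_mem (hD i)]
      rfl
    · intro e
      rw [if_pos e.2, ← hlaw ⟨e.1, e.2.le⟩ e.2, Measure.map_apply (hm _ _) (hs _)]
  · push Not at hD
    obtain ⟨i, hi⟩ := hD
    rw [Finset.prod_eq_zero (Finset.mem_univ (⟨(i, i), le_rfl⟩ : UpperIndex n))
      (by rw [if_neg (lt_irrefl _), Measure.dirac_apply' _ (hs _), Set.indicator_of_notMem hi])]
    refine measure_mono_null (fun ω hω => ?_) (ae_iff.1 hdiag)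
    intro h
    refine hi ?_
    have : G ω i i ∈ s ⟨(i, i), le_rfl⟩ := hω ⟨(i, i), le_rfl⟩ trivial
    rwa [h i] at this

end ConditionalLaws
-- Comparison of the two matrix channels
section Comparison

variable {n : ℕ} {S : Type*} [MeasurableSpace S] [DiscreteMeasurableSpace S]

/-- The channel from the signal to the entries of the graph on and above the diagonal. -/
noncomputable def graphKernel (d : ℝ) (x : S → Fin n → Fin n → ℝ) (e : UpperIndex n) :
    Kernel S ℝ :=
  if e.1.1 < e.1.2 then
    -- The projection only supplies a term of the unit interval; it acts as the identity on edge
    -- probabilities already in `[0, 1]`.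
    bernoulliKernel fun w => Set.projIcc 0 1 zero_le_one (edgeProb n d (x w e.1.1 e.1.2))
  else Kernel.const S (Measure.dirac 0)

/-- The channel from the signal to the entries of the spiked Wigner matrix on and above the
diagonal. -/
noncomputable def wignerKernel (x : S → Fin n → Fin n → ℝ) (e : UpperIndex n) : Kernel S ℝ :=
  gaussianKernel (fun w => x w e.1.1 e.1.2) (if e.1.1 < e.1.2 then 1 else 2)

instance (d : ℝ) (x : S → Fin n → Fin n → ℝ) (e : UpperIndex n) :
    IsMarkovKernel (graphKernel d x e) := by
  unfold graphKernel; split_ifs <;> infer_instance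

instance (x : S → Fin n → Fin n → ℝ) (e : UpperIndex n) : IsMarkovKernel (wignerKernel x e) := by
  unfold wignerKernel; infer_instance

variable [StandardBorelSpace S] [Nonempty S] {d s ε : ℝ} {x : S → Fin n → Fin n → ℝ}

lemma channelInfo_wignerKernel_diag_le (hx : ∀ w i j, |x w i j| ≤ ε) {e : UpperIndex n}
    (he : ¬ e.1.1 < e.1.2) (ρ : Measure S) [IsProbabilityMeasure ρ] :
    channelInfo ρ (wignerKernel x e) ≤ ENNReal.ofReal (ε ^ 2) := by
  rw [wignerKernel, if_neg he]
  refine (channelInfo_gaussianKernel_le_sq ρ two_ne_zero fun w => hx w _ _).trans ?_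
  refine ENNReal.ofReal_le_ofReal ?_
  rw [NNReal.coe_ofNat]
  linarith [sq_nonneg ε]

lemma channelInfo_piKernel_wignerKernel_ne_top (hx : ∀ w i j, |x w i j| ≤ ε)
    (ρ : Measure S) [IsProbabilityMeasure ρ] :
    channelInfo ρ (piKernel (wignerKernel x)) ≠ ∞ := by
  have h : ∀ e (ρ : Measure S) [IsProbabilityMeasure ρ],
      channelInfo ρ (wignerKernel x e) ≤ ENNReal.ofReal (ε ^ 2 / (2 *
        ((if e.1.1 < e.1.2 then 1 else 2 : ℝ≥0) : ℝ))) := fun e ρ _ =>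
    channelInfo_gaussianKernel_le_sq ρ (by split_ifs <;> simp) fun w => hx w _ _
  exact ne_top_of_le_ne_top (ENNReal.sum_ne_top.2 fun _ _ => ENNReal.ofReal_ne_top)
    (channelInfo_piKernel_le_sum (wignerKernel x) _ h ρ)

variable [Finite S] in
-- Off the diagonal the scalar comparison applies. On it no cancellation is needed: the graph entry
-- carries no information and the Gaussian one at most `ε²`.
lemma channelInfo_graphKernel_wignerKernel (hd : d / n ∈ Set.Ioo (0 : ℝ) 1) (hs0 : 0 < s)
    (hs : s ^ 2 = d / n * (1 - d / n)) (hx : ∀ w i j, |x w i j| ≤ ε)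
    (hp : ∀ w i j, i < j → edgeProb n d (x w i j) ∈ Set.Icc (0 : ℝ) 1)
    (ρ : Measure S) [IsProbabilityMeasure ρ] :
    channelInfo ρ (piKernel (graphKernel d x)) ≤ channelInfo ρ (piKernel (wignerKernel x))
        + (n ^ 2 * ENNReal.ofReal (201 * (ε ^ 3 / s)) + n * ENNReal.ofReal (ε ^ 2)) ∧
      channelInfo ρ (piKernel (wignerKernel x)) ≤ channelInfo ρ (piKernel (graphKernel d x))
        + (n ^ 2 * ENNReal.ofReal (201 * (ε ^ 3 / s)) + n * ENNReal.ofReal (ε ^ 2)) := by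
  have hsd : √(d / n * (1 - d / n)) = s := by rw [← hs, Real.sqrt_sq hs0.le]
  have hedge : ∀ (e : UpperIndex n), e.1.1 < e.1.2 → ∀ (ρ : Measure S) [IsProbabilityMeasure ρ],
      channelInfo ρ (graphKernel d x e) ≤
          channelInfo ρ (wignerKernel x e) + ENNReal.ofReal (201 * (ε ^ 3 / s)) ∧
        channelInfo ρ (wignerKernel x e) ≤
          channelInfo ρ (graphKernel d x e) + ENNReal.ofReal (201 * (ε ^ 3 / s)) := by
    intro e he ρ _
    rw [graphKernel, wignerKernel, if_pos he, if_pos he]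
    refine channelInfo_bernoulliKernel_gaussianKernel ρ hd hs0 hs (fun w => ?_)
      fun w => hx w _ _
    rw [Set.projIcc_of_mem zero_le_one (hp w _ _ he), ← hsd]
    rfl
  constructor
  · refine (channelInfo_piKernel_le_add (graphKernel d x) (wignerKernel x)
      (fun e => if e.1.1 < e.1.2 then ENNReal.ofReal (201 * (ε ^ 3 / s))
        else ENNReal.ofReal (ε ^ 2)) (fun e ρ _ => ?_) ρ).trans ?_
    · split_ifs with he
      · exact (hedge e he ρ).1
      · rw [graphKernel, if_neg he, channelInfo_const]
        exact zero_le
    · gcongr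
      exact sum_upperIndex_le _ _
  · refine (channelInfo_piKernel_le_add (wignerKernel x) (graphKernel d x)
      (fun e => if e.1.1 < e.1.2 then ENNReal.ofReal (201 * (ε ^ 3 / s))
        else ENNReal.ofReal (ε ^ 2)) (fun e ρ _ => ?_) ρ).trans ?_
    · split_ifs with he
      · exact (hedge e he ρ).2
      · exact (channelInfo_wignerKernel_diag_le hx he ρ).trans le_add_self
    · gcongr
      exact sum_upperIndex_le _ _

end Comparison

/-! ### Real-valued error bound and conclusion -/

lemma abs_toReal_sub_toReal_le {a b : ℝ≥0∞} {c : ℝ} (hb : b ≠ ∞) (hc : 0 ≤ c)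
    (hab : a ≤ b + ENNReal.ofReal c) (hba : b ≤ a + ENNReal.ofReal c) :
    a ≠ ∞ ∧ |a.toReal - b.toReal| ≤ c := by
  have ha : a ≠ ∞ := ne_top_of_le_ne_top (ENNReal.add_ne_top.2 ⟨hb, ENNReal.ofReal_ne_top⟩) hab
  refine ⟨ha, ?_⟩
  have h1 := ENNReal.toReal_mono (ENNReal.add_ne_top.2 ⟨hb, ENNReal.ofReal_ne_top⟩) hab
  have h2 := ENNReal.toReal_mono (ENNReal.add_ne_top.2 ⟨ha, ENNReal.ofReal_ne_top⟩) hba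
  rw [ENNReal.toReal_add hb ENNReal.ofReal_ne_top, ENNReal.toReal_ofReal hc] at h1
  rw [ENNReal.toReal_add ha ENNReal.ofReal_ne_top, ENNReal.toReal_ofReal hc] at h2
  rw [abs_le]
  constructor <;> linarith

/-- Since `√(d(n - d)) = n s`, the ratio on the right is `√n / s`. It is at least `1`, so it absorbs
the diagonal contribution `B²`. -/
lemma edge_error_le {n : ℕ} {d B s : ℝ} (hn : 0 < n) (hd0 : 0 < d) (hdn : d < n)
    (hs0 : 0 < s) (hs : s ^ 2 = d / n * (1 - d / n)) :
    (n : ℝ) ^ 2 * (201 * ((B / √(n : ℝ)) ^ 3 / s)) + n * (B / √(n : ℝ)) ^ 2 ≤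
      (201 * B ^ 3 + B ^ 2) * ((n : ℝ) ^ (3 / 2 : ℝ) / √(d * (n - d))) := by
  have hn' : (0 : ℝ) < n := by exact_mod_cast hn
  have hn1 : (1 : ℝ) ≤ n := by exact_mod_cast hn
  set t := √(n : ℝ) with ht
  have ht0 : 0 < t := Real.sqrt_pos.2 hn'
  have htt : t ^ 2 = n := Real.sq_sqrt hn'.le
  have ht1 : 1 ≤ t := Real.one_le_sqrt.2 hn1
  have hpow : (n : ℝ) ^ (3 / 2 : ℝ) = t ^ 3 := by
    rw [ht, Real.sqrt_eq_rpow, ← Real.rpow_natCast, ← Real.rpow_mul hn'.le]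
    norm_num
  have hsn : √(d * (n - d)) = n * s := by
    rw [Real.sqrt_eq_iff_mul_self_eq (mul_nonneg hd0.le (sub_nonneg.2 hdn.le)) (by positivity)]
    have : n * s * (n * s) = (n : ℝ) ^ 2 * s ^ 2 := by ring
    rw [this, hs]
    field_simp
  have hs1 : s ≤ 1 := by
    have : s ^ 2 ≤ 1 := by rw [hs]; nlinarith [sq_nonneg (d / n - 1 / 2)]
    nlinarith
  rw [hpow, hsn, ← htt]
  have e1 : (t ^ 2) ^ 2 * (201 * ((B / t) ^ 3 / s)) = 201 * B ^ 3 * (t ^ 3 / (t ^ 2 * s)) := by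
    field_simp
  have e2 : t ^ 2 * (B / t) ^ 2 = B ^ 2 * 1 := by field_simp
  have h1 : 1 ≤ t ^ 3 / (t ^ 2 * s) := by
    rw [le_div_iff₀ (by positivity), one_mul]
    nlinarith [pow_pos ht0 2]
  rw [e1, e2, add_mul]
  exact add_le_add le_rfl (mul_le_mul_of_nonneg_left h1 (sq_nonneg B))

end ChannelUniversality

theorem theorem6 (δ : ℝ) (hδ : 0 < δ) (B : ℝ) :
    ∃ C : ℝ, ∀ (n : ℕ) (d : ℝ), d ∈ Set.Icc δ (n - δ) →
      ∀ (Ω : Type*) [MeasurableSpace Ω] (P : Measure Ω) [IsProbabilityMeasure P]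
        (W G ξ : Ω → Fin n → Fin n → ℝ) (N : ℕ),
        Measurable W →
        (∀ᵐ ω ∂P, ∀ i j, W ω i j = W ω j i) →
        (∀ᵐ ω ∂P, ∀ i j, |W ω i j| ≤ B / √(n : ℝ)) →
        (P.map W).support.Finite →
        (P.map W).support.ncard = N →
        ChannelUniversality.IsBernoulliGraph d W G P →
        ChannelUniversality.IsGaussianWigner ξ P →
        IndepFun W ξ P →
        ChannelUniversality.mutualInfo W G P ≠ ⊤ ∧
        ChannelUniversality.mutualInfo W (fun ω => W ω + ξ ω) P ≠ ⊤ ∧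
        |(ChannelUniversality.mutualInfo W G P).toReal
            - (ChannelUniversality.mutualInfo W (fun ω => W ω + ξ ω) P).toReal|
          ≤ C * (((n : ℝ) ^ (3 / 2 : ℝ) + n * √(Real.log N)) / √(d * (n - d))
                + n * Real.log N / (d * (n - d))) := by
  -- The cubic part comes from the edges, the quadratic part from the diagonal.
  refine ⟨201 * B ^ 3 + B ^ 2, ?_⟩
  intro n d hd Ω _ P _ W G ξ N hW hWs hWB hfin _ hG hξ hWξ
  have hd0 : 0 < d := hδ.trans_le hd.1
  have hdn : d < n := by linarith [hd.2]
  have hn' : (0 : ℝ) < n := hd0.trans hdn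
  have hn : 0 < n := by exact_mod_cast hn'
  have hq : d / n ∈ Set.Ioo (0 : ℝ) 1 := ⟨by positivity, (div_lt_one hn').2 hdn⟩
  have hqq : 0 < d / n * (1 - d / n) := mul_pos hq.1 (sub_pos.2 hq.2)
  obtain ⟨s, hs0, hs⟩ : ∃ s : ℝ, 0 < s ∧ s ^ 2 = d / n * (1 - d / n) :=
    ⟨√(d / n * (1 - d / n)), Real.sqrt_pos.2 hqq, Real.sq_sqrt hqq.le⟩
  have hB : 0 ≤ B := by
    obtain ⟨ω, hω⟩ := hWB.exists
    have h := (abs_nonneg _).trans (hω ⟨0, hn⟩ ⟨0, hn⟩)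
    by_contra hneg
    exact absurd h (not_le.2 (div_neg_of_neg_of_pos (not_le.1 hneg) (Real.sqrt_pos.2 hn')))
  have hsupp : ∀ᵐ ω ∂P, W ω ∈ (P.map W).support :=
    ae_of_ae_map hW.aemeasurable Measure.support_mem_ae
  have hfinA : (ChannelUniversality.atoms W P).Finite :=
    hfin.subset (ChannelUniversality.atoms_subset_of_finite hsupp)
  obtain ⟨hne, f, hf, hfW, hfc⟩ := ChannelUniversality.exists_atom_encoding hfin hsupp
  have hfinS : Finite (ChannelUniversality.atoms W P) := hfinA
  let x : ChannelUniversality.atoms W P → Fin n → Fin n → ℝ := fun a => a.1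
  have hx : ∀ a i j, |x a i j| ≤ B / √(n : ℝ) := by
    have := ChannelUniversality.atoms_subset_of_finite
      (A := {w : Fin n → Fin n → ℝ | ∀ i j, |w i j| ≤ B / √(n : ℝ)}) hWB
    exact fun a => this a.2
  have hp : ∀ a i j, i < j → ChannelUniversality.edgeProb n d (x a i j) ∈ Set.Icc (0 : ℝ) 1 := by
    intro a i j hij
    -- The Bernoulli law at an atom already carries the constraint that its parameter lies in `[0,
    -- 1]`.
    obtain ⟨p, hp, -⟩ := hG.law a.1 a.2 i j hij
    rw [← hp]
    exact p.2
  have hρ : IsProbabilityMeasure (P.map fun ω => f (W ω)) :=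
    Measure.isProbabilityMeasure_map (μ := P) (hf.comp hW).aemeasurable
  have hIG := ChannelUniversality.mutualInfo_eq_channelInfo_upper hW hG.measurable hG.symm hf hfW hfc
    (ChannelUniversality.piKernel (ChannelUniversality.graphKernel d x)) (fun a => by
      rw [hG.cond_map_upperEntries a.2
        (fun e => Set.projIcc 0 1 zero_le_one (ChannelUniversality.edgeProb n d (x a e.1.1 e.1.2)))
        fun e he => by rw [Set.projIcc_of_mem zero_le_one (hp a _ _ he)]]
      rw [ChannelUniversality.piKernel_apply]
      congr 1
      ext1 e
      rw [ChannelUniversality.graphKernel]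
      split_ifs <;> rfl)
  have hZs : ∀ᵐ ω ∂P, ∀ i j, (W ω + ξ ω) i j = (W ω + ξ ω) j i := by
    filter_upwards [hWs, hξ.symm] with ω h1 h2 i j
    rw [Pi.add_apply, Pi.add_apply, Pi.add_apply, Pi.add_apply, h1, h2]
  have hIZ := ChannelUniversality.mutualInfo_eq_channelInfo_upper hW (hW.add hξ.measurable) hZs
    hf hfW hfc (ChannelUniversality.piKernel (ChannelUniversality.wignerKernel x))
    fun a => hξ.cond_map_upperEntries_add hW hWξ a.2
  obtain ⟨h1, h2⟩ := ChannelUniversality.channelInfo_graphKernel_wignerKernel hq hs0 hs hx hp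
    (P.map fun ω => f (W ω))
  have htop := ChannelUniversality.channelInfo_piKernel_wignerKernel_ne_top hx
    (P.map fun ω => f (W ω))
  rw [← hIG, ← hIZ] at h1 h2
  rw [← hIZ] at htop
  have hε0 : 0 ≤ B / √(n : ℝ) := by positivity
  have hc0 : 0 ≤ (n : ℝ) ^ 2 * (201 * ((B / √(n : ℝ)) ^ 3 / s)) + n * (B / √(n : ℝ)) ^ 2 := by
    positivity
  have hc : (n : ENNReal) ^ 2 * ENNReal.ofReal (201 * ((B / √(n : ℝ)) ^ 3 / s))
      + n * ENNReal.ofReal ((B / √(n : ℝ)) ^ 2) = ENNReal.ofReal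
        ((n : ℝ) ^ 2 * (201 * ((B / √(n : ℝ)) ^ 3 / s)) + n * (B / √(n : ℝ)) ^ 2) := by
    rw [ENNReal.ofReal_add (by positivity) (by positivity), ENNReal.ofReal_mul (p := (n : ℝ) ^ 2) (by positivity),
      ENNReal.ofReal_mul (p := (n : ℝ)) (by positivity), ENNReal.ofReal_pow hn'.le, ENNReal.ofReal_natCast]
  rw [hc] at h1 h2
  obtain ⟨hGtop, hle⟩ := ChannelUniversality.abs_toReal_sub_toReal_le htop hc0 h1 h2
  refine ⟨hGtop, htop, hle.trans ((ChannelUniversality.edge_error_le hn hd0 hdn hs0 hs).trans ?_)⟩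
  have hdd : 0 < d * (n - d) := mul_pos hd0 (sub_pos.2 hdn)
  have hlog : 0 ≤ Real.log N := Real.log_natCast_nonneg N
  refine mul_le_mul_of_nonneg_left ?_ (by positivity)
  -- Isolate the `n^{3/2}` term; the two logarithmic terms are nonnegative.
  rw [add_div, add_assoc]
  exact le_add_of_nonneg_right (by positivity)
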